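/- **Theorem 1 (Parallel Hamiltonian simulation).** Let $A_1,\dots,A_Q$ be Hermitian $N\times N$ matrices with $|(A_q)_{jk}|\le M$ for all $q,j,k$ (for instance $M=M_A$, the largest absolute value of an entry of these matrices), let $t\in\mathbb R$ and $\varepsilon>0$. Suppose that the entries are accessible through a quantum oracle $$|q\rangle|j\rangle|k\rangle|s\rangle\mapsto|q\rangle|j\rangle|k\rangle|s\oplus z_{q,jk}\rangle ,$$ where $z_{q,jk}$ is a binary word that holds $(A_q)_{jk}$ in fixed-point format (two's complement for the real and the imaginary part, with a known unit), exactly or with an error $\delta$ such that $8|t|\delta\le\varepsilon$, and where the oracle acts trivially on out-of-range addresses. Suppose that the oracle is efficient: one call takes time $\tau=O(\mathrm{polylog}(N^2Q))$, and $\tau$ is at least the number of output bits. Then the unitary operation $$U=\sum_{q=1}^{Q}|q\rangle\langle q|\otimes e^{-i\frac{A_q}{N}t}\qquad\text{on } \mathbb C^Q\otimes\mathbb C^N,$$ where $|1\rangle,\dots,|Q\rangle$ is the computational basis of $\mathbb C^Q$, can be simulated within spectral-norm error $\varepsilon$ in time $$O\!\left(\max\{1,M^2t^2/\varepsilon\}\,\mathrm{polylog}(N^2Q)\right),$$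 that is, in time $O(M_A^2t^2\,\mathrm{polylog}(N^2Q)/\varepsilon)$ when $M=M_A$ and $M_A^2t^2\ge\varepsilon$. In detail: $\mathrm{polylog}(x)$ stands for a bound $c\,(1+\log x)^k$. For all $c_0,k_0$ there are $C,k$ such that for all $Q,N\ge1$, all word lengths, units, $M,t,\varepsilon$ and all $\tau\le c_0(1+\log(N^2Q))^{k_0}$ as above there is a quantum circuit, the same for all admissible $A_1,\dots,A_Q$ and all oracles for them, with the following properties. It acts on qubits that hold $|q\rangle|j\rangle$ in binary and on ancilla qubits in the state $|0\cdots0\rangle$, which are discarded at the end, and it consists of oracle calls and of one-qubit unitaries with at most two control qubits. Its time, in which each ancilla and each gate counts $1$ and each oracle call counts $\tau$, is at most $C\max\{1,M^2t^2/\varepsilon\}(1+\log(N^2Q))^k$. For every density matrix $\sigma$ on $\mathbb C^r\otimes\mathbb C^Q\otimes\mathbb C^N$, with a reference system $\mathbb C^r$ of any finite dimension on which the circuit does not act, the output differs from $(I\otimes U)\sigma(I\otimes U)^\dagger$ by at most $\varepsilon$ in spectral norm. -/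

import Mathlib

/-! Quantum circuits with an entry oracle for a list of matrices, and the channels they realize. -/

namespace ParHamSim

open scoped Kronecker Matrix

/-- The `m` lowest binary digits of `j`: the computational basis label of `j` in `m` qubits. -/
def label (m j : ℕ) : Fin m → Bool := fun i => j.testBit i

/-- The number of qubits of a register whose basis states are labelled by `0, …, n - 1`. -/
def width (n : ℕ) : ℕ := Nat.clog 2 n

/-- A complex number in fixed-point format: the words of its real and of its imaginary part, each
with `b + 1` bits. -/
abbrev Word (b : ℕ) : Type := (Fin (b + 1) → Bool) × (Fin (b + 1) → Bool)

/-- The real number that a word of `b + 1` bits stands for: a two's complement integer, multiplied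
by the unit `u` of the format. -/
noncomputable def fixedPoint (u : ℝ) {b : ℕ} (z : Fin (b + 1) → Bool) : ℝ :=
  u * ((∑ i : Fin b, if z i.castSucc then (2 : ℝ) ^ (i : ℕ) else 0)
    - if z (Fin.last b) then (2 : ℝ) ^ b else 0)

/-- The complex number that a word stands for. -/
noncomputable def Word.value (u : ℝ) {b : ℕ} (z : Word b) : ℂ :=
  ⟨fixedPoint u z.1, fixedPoint u z.2⟩

/-- The stored entries of `Q` matrices of size `N × N`. -/
abbrev Table (Q N b : ℕ) : Type := Fin Q → Fin N → Fin N → Word b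

/-- The word at the address `(x, y, z)`, three strings of qubit values; it is zero if the address is
out of range. -/
def Table.lookup {Q N b : ℕ} (Z : Table Q N b) (x : Fin (width Q) → Bool)
    (y z : Fin (width N) → Bool) : Word b :=
  if h : Nat.ofBits x < Q ∧ Nat.ofBits y < N ∧ Nat.ofBits z < N then
    Z ⟨Nat.ofBits x, h.1⟩ ⟨Nat.ofBits y, h.2.1⟩ ⟨Nat.ofBits z, h.2.2⟩
  else (fun _ => false, fun _ => false)

/-- The qubits on which the oracle acts: the address registers (number of the matrix, row, column)
and the two output registers. -/
inductive OracleWire (Q N b : ℕ) : Type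
  | block (i : Fin (width Q))
  | row (i : Fin (width N))
  | col (i : Fin (width N))
  | re (i : Fin (b + 1))
  | im (i : Fin (b + 1))

/-- The gates on qubits indexed by `W`: an arbitrary one-qubit unitary with at most two control
qubits (in particular all one-qubit gates, CNOT and Toffoli), and the oracle, applied to any choice
of distinct qubits. -/
inductive Gate (Q N b : ℕ) (W : Type) : Type
  | elementary (controls : Finset W) (card_le : controls.card ≤ 2) (target : W)
      (notMem : target ∉ controls) (U : Matrix.unitaryGroup Bool ℂ)
  | oracle (place : OracleWire Q N b ↪ W)

section Semantics

variable {Q N b : ℕ} {W : Type} [Fintype W] [DecidableEq W]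

/-- The matrix of a gate in the computational basis. The oracle is the permutation
`|q⟩|j⟩|k⟩|s⟩ ↦ |q⟩|j⟩|k⟩|s ⊕ Z q j k⟩`. -/
noncomputable def Gate.toMatrix (Z : Table Q N b) : Gate Q N b W → Matrix (W → Bool) (W → Bool) ℂ
  | .elementary controls _ target _ U => Matrix.of fun x y =>
      if ∀ i ∈ controls, x i = true then
        if ∀ i, i ≠ target → x i = y i then (U : Matrix Bool Bool ℂ) (x target) (y target) else 0
      else if x = y then 1 else 0
  | .oracle place => Matrix.of fun x y =>
      let s := Z.lookup (fun i => y (place (.block i))) (fun i => y (place (.row i)))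
        (fun i => y (place (.col i)))
      if (∀ i, x (place (.re i)) = xor (y (place (.re i))) (s.1 i)) ∧
          (∀ i, x (place (.im i)) = xor (y (place (.im i))) (s.2 i)) ∧
          (∀ w, (∀ i, w ≠ place (.re i)) → (∀ i, w ≠ place (.im i)) → x w = y w)
      then 1 else 0

/-- The unitary of a sequence of gates; the head of the list is applied first. -/
noncomputable def listMatrix (Z : Table Q N b) :
    List (Gate Q N b W) → Matrix (W → Bool) (W → Bool) ℂ
  | [] => 1
  | g :: l => listMatrix Z l * g.toMatrix Z

end Semantics

/-- The time of a gate: `τ` for the oracle, one for every other gate. -/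
def Gate.time (τ : ℕ) {Q N b : ℕ} {W : Type} : Gate Q N b W → ℕ
  | .elementary .. => 1
  | .oracle _ => τ

/-- The qubits that hold the input and the output, a state of `ℂ^Q ⊗ ℂ^N`. -/
abbrev SysWire (Q N : ℕ) : Type := Fin (width Q) ⊕ Fin (width N)

/-- A circuit on the qubits of the system and on some ancilla qubits. It does not contain the
table: the same circuit is run with different oracles. -/
structure Circuit (Q N b : ℕ) where
  ancillas : ℕ
  gates : List (Gate Q N b (SysWire Q N ⊕ Fin ancillas))

/-- The running time when an oracle call takes time `τ`: every ancilla qubit (for its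
initialization) and every elementary gate takes one unit of time. -/
def Circuit.time (τ : ℕ) {Q N b : ℕ} (c : Circuit Q N b) : ℕ :=
  c.ancillas + (c.gates.map (Gate.time τ)).sum

/-- The computational basis state of the system qubits that represents `|q⟩|j⟩`. -/
def sysLabel {Q N : ℕ} (p : Fin Q × Fin N) : SysWire Q N → Bool :=
  Sum.elim (label (width Q) p.1) (label (width N) p.2)

/-- The operator `σ` on `ℂ^r ⊗ ℂ^Q ⊗ ℂ^N`, as an operator on `ℂ^r` and the system qubits. -/
noncomputable def encode {r Q N : ℕ}
    (σ : Matrix (Fin r × (Fin Q × Fin N)) (Fin r × (Fin Q × Fin N)) ℂ) :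
    Matrix (Fin r × (SysWire Q N → Bool)) (Fin r × (SysWire Q N → Bool)) ℂ :=
  let J : Matrix (SysWire Q N → Bool) (Fin Q × Fin N) ℂ :=
    Matrix.of fun x p => if x = sysLabel p then 1 else 0
  ((1 : Matrix (Fin r) (Fin r) ℂ) ⊗ₖ J) * σ * ((1 : Matrix (Fin r) (Fin r) ℂ) ⊗ₖ J)ᴴ

/-- Adjoin ancilla qubits in the state `|0⋯0⟩`. -/
noncomputable def adjoinZeros {r a : ℕ} {S : Type}
    (ω : Matrix (Fin r × (S → Bool)) (Fin r × (S → Bool)) ℂ) :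
    Matrix (Fin r × (S ⊕ Fin a → Bool)) (Fin r × (S ⊕ Fin a → Bool)) ℂ :=
  Matrix.of fun x y =>
    if (∀ i, x.2 (.inr i) = false) ∧ (∀ i, y.2 (.inr i) = false) then
      ω (x.1, fun w => x.2 (.inl w)) (y.1, fun w => y.2 (.inl w))
    else 0

/-- The partial trace over the ancilla qubits. -/
noncomputable def traceAncillas {r a : ℕ} {S : Type}
    (ω : Matrix (Fin r × (S ⊕ Fin a → Bool)) (Fin r × (S ⊕ Fin a → Bool)) ℂ) :
    Matrix (Fin r × (S → Bool)) (Fin r × (S → Bool)) ℂ :=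
  Matrix.of fun x y =>
    ∑ z : Fin a → Bool, ω (x.1, Sum.elim x.2 z) (y.1, Sum.elim y.2 z)

/-- The output of the circuit on the input `σ`: encode `σ` in the system qubits, adjoin the ancillas,
apply the gates, discard the ancillas. The factor `ℂ^r` is a reference system, on which the circuit
does not act. -/
noncomputable def Circuit.output {Q N b : ℕ} (c : Circuit Q N b) (Z : Table Q N b) {r : ℕ}
    (σ : Matrix (Fin r × (Fin Q × Fin N)) (Fin r × (Fin Q × Fin N)) ℂ) :
    Matrix (Fin r × (SysWire Q N → Bool)) (Fin r × (SysWire Q N → Bool)) ℂ :=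
  let V := (1 : Matrix (Fin r) (Fin r) ℂ) ⊗ₖ listMatrix Z c.gates
  traceAncillas (V * adjoinZeros (encode σ) * Vᴴ)

open scoped Matrix.Norms.L2Operator in
/-- The spectral norm of a matrix. -/
noncomputable def spectralNorm {n : Type} [Fintype n] [DecidableEq n] (M : Matrix n n ℂ) : ℝ := ‖M‖

open scoped ComplexOrder in
/-- Run with the table `Z`, the circuit simulates the unitary operation `U` on `ℂ^Q ⊗ ℂ^N` within
spectral-norm error `ε`: on every density matrix `σ`, also of a system that is entangled with a
reference system, its output differs from `U σ U†` by at most `ε` in spectral norm. -/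
def Circuit.Simulates {Q N b : ℕ} (c : Circuit Q N b) (Z : Table Q N b)
    (U : Matrix (Fin Q × Fin N) (Fin Q × Fin N) ℂ) (ε : ℝ) : Prop :=
  ∀ (r : ℕ) (σ : Matrix (Fin r × (Fin Q × Fin N)) (Fin r × (Fin Q × Fin N)) ℂ),
    σ.PosSemidef → σ.trace = 1 →
      spectralNorm (c.output Z σ -
        encode (((1 : Matrix (Fin r) (Fin r) ℂ) ⊗ₖ U) * σ *
          ((1 : Matrix (Fin r) (Fin r) ℂ) ⊗ₖ U)ᴴ)) ≤ ε

/-- The largest absolute value of an entry of the matrices. -/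
noncomputable def maxAbsEntry {Q N : ℕ} (A : Fin Q → Matrix (Fin N) (Fin N) ℂ) : ℝ :=
  ⨆ p : Fin Q × Fin N × Fin N, ‖A p.1 p.2.1 p.2.2‖

/-- The operation `∑ q, |q⟩⟨q| ⊗ exp (-i (A q / N) t)`. -/
noncomputable def parallelEvolution {Q N : ℕ} (A : Fin Q → Matrix (Fin N) (Fin N) ℂ) (t : ℝ) :
    Matrix (Fin Q × Fin N) (Fin Q × Fin N) ℂ :=
  ∑ q, Matrix.single q q (1 : ℂ) ⊗ₖ NormedSpace.exp ((-Complex.I * (t / N : ℂ)) • A q)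

end ParHamSim

/-! The matrix `A q / N` need not be sparse, but it is a compression of a one-sparse Hamiltonian on
a larger space. Let `w = width N`, and attach a displacement `d` of `w` bits and a flag. Let `G`
couple `|j⟩|d⟩|0⟩` with `|j ⊕ d⟩|d⟩|1⟩`, with the matrix entry at `(j, j ⊕ d)` as amplitude. This is
a direct sum of two-by-two blocks (`generator`). Let `ι` be the isometry that puts displacement and
flag in the uniform superposition. For given `j` and `k` exactly one displacement leads from one to
the other, so all entries occur in `ιᴴ G ι` with the same weight `2 ^ (-w)`, and this compression is
the padded matrix divided by `2 ^ w` (`uniformIsometry_generator`). The excess of `2 ^ w` over `N`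
is absorbed into the time step.

To first order, the evolution under `G` is cheap to implement. Two coupled states lead to the same
oracle address and then differ only in the flag (`exchange_eq`). A step therefore computes the
address, reads the word, rotates the flag by angles given digit by digit, once for the real and once
for the imaginary part, and uncomputes (`listMatrix_stepGates`).

The ancillas are then discarded. In the Heisenberg picture a step maps `O` to `(T ι)ᴴ (O ⊗ 1) (T ι)`
with `T` close to the identity. Since `(O ⊗ 1) ι = ι O`, the terms of order zero and one depend on
`T` only through the compression of its generator, so they agree with those of conjugation by the
exponential of this compression (`norm_conj_sub_first_order_le`). If the rescaled entries are at
most `m`, the error of a step is `O(m ^ 2)` plus the rounding error of the table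
(`norm_dualChannel_stepGates_sub_le`). With `n` steps `m` is of order `|t| M / n`, apart from
rounding, and the errors add up to about `M ^ 2 t ^ 2 / n` (`norm_dualChannel_iterate_sub_le`).
Hence `n` of order `max 1 (M ^ 2 t ^ 2 / ε)` suffices, and every step costs polylogarithmic time.

The operator norm on observables is dual to the trace norm on states, so `simulates_of_dualChannel`
gives the required bound in spectral norm, with any reference system included. -/

namespace ParHamSim

open scoped Kronecker Matrix

/-! ### Gates and circuits placed on a larger set of qubits. -/

section GateMap

variable {Q N b : ℕ} {W W' : Type}

/-- The gate `g`, applied to the qubits that are selected by the embedding `f`. -/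
def Gate.map (f : W ↪ W') : Gate Q N b W → Gate Q N b W'
  | .elementary s hs t ht U => .elementary (s.map f) (by simpa using hs) (f t) (by simpa using ht) U
  | .oracle p => .oracle (p.trans f)

@[simp]
theorem Gate.time_map (τ : ℕ) (f : W ↪ W') (g : Gate Q N b W) : (g.map f).time τ = g.time τ := by
  cases g <;> rfl

variable [Fintype W] [DecidableEq W] [Fintype W'] [DecidableEq W']

open Classical in
theorem Gate.toMatrix_map (Z : Table Q N b) (f : W ↪ W') (g : Gate Q N b W) (x y : W' → Bool) :
    (g.map f).toMatrix Z x y =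
      if ∀ w, w ∉ Set.range f → x w = y w then g.toMatrix Z (x ∘ f) (y ∘ f) else 0 := by
  cases g with
  | elementary s hs t ht U =>
    have key : (∀ i, i ≠ f t → x i = y i) ↔
        (∀ w, w ∉ Set.range f → x w = y w) ∧ ∀ i, i ≠ t → x (f i) = y (f i) := by
      constructor
      · intro h
        exact ⟨fun w hw => h w fun e => hw ⟨t, e.symm⟩,
          fun i hi => h _ fun e => hi (f.injective e)⟩
      · rintro ⟨h₁, h₂⟩ i hi
        by_cases hr : i ∈ Set.range f
        · obtain ⟨j, rfl⟩ := hr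
          exact h₂ j fun e => hi (e ▸ rfl)
        · exact h₁ i hr
    have key' : x = y ↔ (∀ w, w ∉ Set.range f → x w = y w) ∧ x ∘ f = y ∘ f := by
      constructor
      · rintro rfl
        simp
      · rintro ⟨h₁, h₂⟩
        funext i
        by_cases hr : i ∈ Set.range f
        · obtain ⟨j, rfl⟩ := hr
          exact congrFun h₂ j
        · exact h₁ i hr
    simp only [Gate.map, Gate.toMatrix, Matrix.of_apply, Finset.mem_map, forall_exists_index,
      and_imp, forall_apply_eq_imp_iff₂, key, key', Function.comp_apply]
    split_ifs <;> simp_all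
  | oracle p =>
    simp only [Gate.map, Gate.toMatrix, Matrix.of_apply, Function.Embedding.trans_apply,
      Function.comp_apply, ← ite_and]
    congr 1
    apply propext
    constructor
    · rintro ⟨h₁, h₂, h₃⟩
      exact ⟨fun w hw => h₃ w (fun i e => hw ⟨_, e.symm⟩) (fun i e => hw ⟨_, e.symm⟩), h₁, h₂,
        fun w a c => h₃ _ (fun i e => a i (f.injective e)) (fun i e => c i (f.injective e))⟩
    · rintro ⟨h₀, h₁, h₂, h₃⟩
      refine ⟨h₁, h₂, fun w a c => ?_⟩
      by_cases hr : w ∈ Set.range f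
      · obtain ⟨j, rfl⟩ := hr
        exact h₃ j (fun i e => a i (e ▸ rfl)) (fun i e => c i (e ▸ rfl))
      · exact h₀ w hr

theorem listMatrix_append (Z : Table Q N b) (l₁ l₂ : List (Gate Q N b W)) :
    listMatrix Z (l₁ ++ l₂) = listMatrix Z l₂ * listMatrix Z l₁ := by
  induction l₁ with
  | nil => simp [listMatrix]
  | cons g l ih => simp [listMatrix, ih, Matrix.mul_assoc]

open Classical in
theorem listMatrix_map (Z : Table Q N b) (f : W ↪ W') (l : List (Gate Q N b W))
    (x y : W' → Bool) :
    listMatrix Z (l.map (Gate.map f)) x y =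
      if ∀ w, w ∉ Set.range f → x w = y w then listMatrix Z l (x ∘ f) (y ∘ f) else 0 := by
  induction l generalizing x y with
  | nil =>
    have key' : x = y ↔ (∀ w, w ∉ Set.range f → x w = y w) ∧ x ∘ f = y ∘ f := by
      constructor
      · rintro rfl
        simp
      · rintro ⟨h₁, h₂⟩
        funext i
        by_cases hr : i ∈ Set.range f
        · obtain ⟨j, rfl⟩ := hr
          exact congrFun h₂ j
        · exact h₁ i hr
    simp only [List.map_nil, listMatrix, Matrix.one_apply, key', ← ite_and]
  | cons g l ih =>
    simp only [List.map_cons, listMatrix, Matrix.mul_apply, ih, Gate.toMatrix_map]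
    split_ifs with h
    · symm
      have hext : ∀ (u : W → Bool) (w : W'), w ∉ Set.range f →
          Function.extend f u x w = x w := fun u w hw =>
        Function.extend_apply' _ _ _ fun ⟨a, ha⟩ => hw ⟨a, ha⟩
      -- Only intermediate states that agree with `x` outside the range of `f` contribute; they are
      -- parametrized by their values on that range.
      refine Fintype.sum_of_injective (fun u : W → Bool => Function.extend f u x) ?_ _ _ ?_ ?_
      · intro u v huv
        funext i
        have := congrFun huv (f i)
        simpa [f.injective.extend_apply] using this
      · intro v hv
        by_cases h' : ∀ w, w ∉ Set.range f → x w = v w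
        · refine absurd ⟨v ∘ f, ?_⟩ hv
          funext w
          by_cases hr : w ∈ Set.range f
          · obtain ⟨j, rfl⟩ := hr
            simp [f.injective.extend_apply]
          · exact (hext _ w hr).trans (h' w hr)
        · rw [if_neg h', zero_mul]
      · intro u
        have e₁ : Function.extend f u x ∘ f = u := funext fun i => f.injective.extend_apply _ _ i
        rw [if_pos (fun w hw => (hext u w hw).symm), if_pos (fun w hw => (hext u w hw).trans (h w hw)),
          e₁]
    · refine Finset.sum_eq_zero fun v _ => ?_
      by_cases h₁ : ∀ w, w ∉ Set.range f → x w = v w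
      · rw [if_neg (c := ∀ w, w ∉ Set.range f → v w = y w), mul_zero]
        exact fun h₂ => h fun w hw => (h₁ w hw).trans (h₂ w hw)
      · rw [if_neg h₁, zero_mul]

end GateMap

/-! ### Kraus operators and composition of channels. -/

section Kraus

variable {Q N b : ℕ}

/-- The Kraus operator of a unitary on system and ancilla qubits, for ancillas that start in
`|0⋯0⟩` and end in the basis state `z`. -/
def krausOp {S A : Type} (L : Matrix (S ⊕ A → Bool) (S ⊕ A → Bool) ℂ) (z : A → Bool) :
    Matrix (S → Bool) (S → Bool) ℂ :=
  Matrix.of fun x y => L (Sum.elim x z) (Sum.elim y fun _ => false)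

/-- The adjoint channel, on observables of the reference system and the system qubits. -/
noncomputable def dualChannel {S A : Type} [Fintype S] [DecidableEq S] [Fintype A] [DecidableEq A]
    (L : Matrix (S ⊕ A → Bool) (S ⊕ A → Bool) ℂ) {r : ℕ}
    (O : Matrix (Fin r × (S → Bool)) (Fin r × (S → Bool)) ℂ) :
    Matrix (Fin r × (S → Bool)) (Fin r × (S → Bool)) ℂ :=
  ∑ z : A → Bool, ((1 : Matrix (Fin r) (Fin r) ℂ) ⊗ₖ krausOp L z)ᴴ * O *
    ((1 : Matrix (Fin r) (Fin r) ℂ) ⊗ₖ krausOp L z)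

/-- The circuit without gates and ancillas. -/
def Circuit.empty : Circuit Q N b := ⟨0, []⟩

/-- The circuit `c₁`, followed by the circuit `c₂` with fresh ancillas. -/
def Circuit.comp (c₁ c₂ : Circuit Q N b) : Circuit Q N b where
  ancillas := c₁.ancillas + c₂.ancillas
  gates := c₁.gates.map (Gate.map
      ((Function.Embedding.refl _).sumMap (Fin.castAddEmb c₂.ancillas))) ++
    c₂.gates.map (Gate.map ((Function.Embedding.refl _).sumMap (Fin.natAddEmb c₁.ancillas)))

/-- The `n`-fold repetition of a circuit, each time with fresh ancillas. -/
def Circuit.iterate (c : Circuit Q N b) : ℕ → Circuit Q N b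
  | 0 => Circuit.empty
  | n + 1 => (c.iterate n).comp c

theorem Circuit.time_comp (τ : ℕ) (c₁ c₂ : Circuit Q N b) :
    (c₁.comp c₂).time τ = c₁.time τ + c₂.time τ := by
  simp only [Circuit.time, Circuit.comp, List.map_append, List.map_map, List.sum_append]
  have h : ∀ {W W' : Type} (f : W ↪ W'),
      Gate.time τ ∘ Gate.map f = (Gate.time τ : Gate Q N b W → ℕ) :=
    fun f => funext fun g => Gate.time_map τ f g
  rw [h, h]
  omega

theorem Circuit.time_iterate (τ : ℕ) (c : Circuit Q N b) (n : ℕ) :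
    (c.iterate n).time τ = n * c.time τ := by
  induction n with
  | zero => simp [Circuit.iterate, Circuit.empty, Circuit.time]
  | succ n ih => rw [Circuit.iterate, Circuit.time_comp, ih]; ring

/-- Neither circuit touches the ancillas of the other. Between the two, the first group of ancillas
is thus already in its final state `z₁` and the second is still zero, so the intermediate sum runs
over the system qubits only. -/
theorem krausOp_append_map (Z : Table Q N b) {S : Type} [Fintype S] [DecidableEq S] {a₁ a₂ : ℕ}
    (l₁ : List (Gate Q N b (S ⊕ Fin a₁))) (l₂ : List (Gate Q N b (S ⊕ Fin a₂)))
    (z₁ : Fin a₁ → Bool) (z₂ : Fin a₂ → Bool) :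
    krausOp (listMatrix Z
      (l₁.map (Gate.map ((Function.Embedding.refl S).sumMap (Fin.castAddEmb a₂))) ++
        l₂.map (Gate.map ((Function.Embedding.refl S).sumMap (Fin.natAddEmb a₁)))))
        (Fin.append z₁ z₂) =
      krausOp (listMatrix Z l₂) z₂ * krausOp (listMatrix Z l₁) z₁ := by
  classical
  ext x y
  symm
  simp only [krausOp, Matrix.of_apply, Matrix.mul_apply, listMatrix_append]
  refine Fintype.sum_of_injective (fun s : S → Bool =>
    (Sum.elim s (Fin.append z₁ fun _ => false) :
      S ⊕ Fin (a₁ + a₂) → Bool)) ?_ _ _ ?_ ?_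
  · intro s s' h
    funext i
    simpa using congrFun h (Sum.inl i)
  · intro u hu
    rw [listMatrix_map, listMatrix_map]
    split_ifs with h₁ h₂
    · refine absurd ⟨fun i => u (.inl i), ?_⟩ hu
      funext w
      rcases w with w | w
      · rfl
      · refine Fin.addCases (fun i => ?_) (fun i => ?_) w
        · have := h₁ (.inr (Fin.castAdd _ i)) (by
            rintro ⟨v | v, hv⟩
            · simp at hv
            · simp [Fin.ext_iff] at hv; omega)
          simpa using this
        · have := h₂ (.inr (Fin.natAdd _ i)) (by
            rintro ⟨v | v, hv⟩
            · simp at hv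
            · simp [Fin.ext_iff] at hv; omega)
          simpa using this.symm
    all_goals simp
  · intro s
    rw [listMatrix_map, listMatrix_map, if_pos, if_pos]
    · congr 2
      · funext w; rcases w with w | w <;> simp
      · funext w; rcases w with w | w <;> simp
      · funext w; rcases w with w | w <;> simp
      · funext w; rcases w with w | w <;> simp
    · rintro (w | w) hw
      · exact absurd ⟨.inl w, rfl⟩ hw
      · induction w using Fin.addCases with
        | left i => exact absurd ⟨.inr i, rfl⟩ hw
        | right i => simp
    · rintro (w | w) hw
      · exact absurd ⟨.inl w, rfl⟩ hw
      · induction w using Fin.addCases with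
        | left i => simp
        | right i => exact absurd ⟨.inr i, rfl⟩ hw

/-- Kraus operators of circuits with separate ancillas multiply. The order is reversed because
observables are pulled back. -/
theorem dualChannel_comp (Z : Table Q N b) (c₁ c₂ : Circuit Q N b) {r : ℕ}
    (O : Matrix (Fin r × (SysWire Q N → Bool)) (Fin r × (SysWire Q N → Bool)) ℂ) :
    dualChannel (listMatrix Z (c₁.comp c₂).gates) O =
      dualChannel (listMatrix Z c₁.gates) (dualChannel (listMatrix Z c₂.gates) O) := by
  have e := (Fin.appendEquiv (α := Bool) c₁.ancillas c₂.ancillas).sum_comp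
    (fun z : Fin (c₁.comp c₂).ancillas → Bool =>
      ((1 : Matrix (Fin r) (Fin r) ℂ) ⊗ₖ krausOp (listMatrix Z (c₁.comp c₂).gates) z)ᴴ * O *
        ((1 : Matrix (Fin r) (Fin r) ℂ) ⊗ₖ krausOp (listMatrix Z (c₁.comp c₂).gates) z))
  refine Eq.trans e.symm ?_
  rw [Fintype.sum_prod_type]
  refine Finset.sum_congr rfl fun z₁ _ => ?_
  rw [dualChannel, Finset.mul_sum, Finset.sum_mul]
  refine Finset.sum_congr rfl fun z₂ _ => ?_
  have h := krausOp_append_map Z c₁.gates c₂.gates z₁ z₂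
  have h' : (1 : Matrix (Fin r) (Fin r) ℂ) ⊗ₖ krausOp (listMatrix Z (c₁.comp c₂).gates)
      (Fin.appendEquiv c₁.ancillas c₂.ancillas (z₁, z₂)) =
      ((1 : Matrix (Fin r) (Fin r) ℂ) ⊗ₖ krausOp (listMatrix Z c₂.gates) z₂) *
      ((1 : Matrix (Fin r) (Fin r) ℂ) ⊗ₖ krausOp (listMatrix Z c₁.gates) z₁) := by
    rw [← Matrix.mul_kronecker_mul, one_mul, ← h]
    rfl
  rw [h', Matrix.conjTranspose_mul]
  simp only [Matrix.mul_assoc]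

theorem dualChannel_empty (Z : Table Q N b) {r : ℕ}
    (O : Matrix (Fin r × (SysWire Q N → Bool)) (Fin r × (SysWire Q N → Bool)) ℂ) :
    dualChannel (listMatrix Z (Circuit.empty : Circuit Q N b).gates) O = O := by
  have h : ∀ z : Fin (Circuit.empty : Circuit Q N b).ancillas → Bool,
      krausOp (listMatrix Z (Circuit.empty : Circuit Q N b).gates) z = 1 := by
    intro z
    ext x y
    have : z = fun _ => false := funext fun i => i.elim0
    subst this
    simp only [krausOp, Circuit.empty, listMatrix, Matrix.of_apply, Matrix.one_apply]
    congr 1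
    apply propext
    constructor
    · intro h
      funext i
      simpa using congrFun h (.inl i)
    · rintro rfl
      rfl
  have hc : Fintype.card (Fin (Circuit.empty : Circuit Q N b).ancillas → Bool) = 1 := by
    exact Fintype.card_eq_one_iff.2 ⟨fun _ => false, fun z => funext fun i => i.elim0⟩
  simp [dualChannel, h, hc]

end Kraus

/-! ### Estimates for the operator norm and the trace. -/

section OperatorNorm

open scoped Matrix.Norms.L2Operator

variable {m n k p p' : Type*} [Fintype m] [Fintype n] [Fintype k] [Fintype p] [Fintype p']
  [DecidableEq n]

theorem norm_le_of_mulVec_le {X : Matrix m n ℂ} {c : ℝ} (hc : 0 ≤ c)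
    (h : ∀ v : n → ℂ, ∑ i, ‖(X *ᵥ v) i‖ ^ 2 ≤ c ^ 2 * ∑ j, ‖v j‖ ^ 2) : ‖X‖ ≤ c := by
  rw [Matrix.l2_opNorm_def]
  refine ContinuousLinearMap.opNorm_le_bound _ hc fun v => ?_
  refine (sq_le_sq₀ (norm_nonneg _) (mul_nonneg hc (norm_nonneg _))).1 ?_
  rw [mul_pow, EuclideanSpace.norm_sq_eq, EuclideanSpace.norm_sq_eq]
  exact h v

theorem sum_norm_sq_mulVec_le (X : Matrix m n ℂ) (v : n → ℂ) :
    ∑ i, ‖(X *ᵥ v) i‖ ^ 2 ≤ ‖X‖ ^ 2 * ∑ j, ‖v j‖ ^ 2 := by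
  have h := X.l2_opNorm_mulVec (WithLp.toLp 2 v)
  have h' := (sq_le_sq₀ (norm_nonneg _) (by positivity)).2 h
  rw [mul_pow, EuclideanSpace.norm_sq_eq, EuclideanSpace.norm_sq_eq] at h'
  exact h'

/-- A direct sum of copies of `X` has norm at most `‖X‖`. -/
theorem norm_direct_sum_le [DecidableEq k] [DecidableEq p'] (e : p ≃ k × m) (e' : p' ≃ k × n) (X : Matrix m n ℂ) :
    ‖(Matrix.of fun x y => if (e x).1 = (e' y).1 then X (e x).2 (e' y).2 else 0 :
      Matrix p p' ℂ)‖ ≤ ‖X‖ := by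
  refine norm_le_of_mulVec_le (norm_nonneg _) fun v => ?_
  rw [← e.symm.sum_comp, ← e'.symm.sum_comp (fun j => ‖v j‖ ^ 2), Fintype.sum_prod_type,
    Fintype.sum_prod_type, Finset.mul_sum]
  refine Finset.sum_le_sum fun i _ => ?_
  refine le_trans (le_of_eq ?_) (sum_norm_sq_mulVec_le X fun j => v (e'.symm (i, j)))
  refine Finset.sum_congr rfl fun j _ => ?_
  congr 2
  simp only [Matrix.mulVec, dotProduct, Matrix.of_apply, Equiv.apply_symm_apply]
  rw [← e'.symm.sum_comp, Fintype.sum_prod_type]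
  simp [Finset.sum_ite_irrel]

theorem norm_one_kronecker_le (r : ℕ) (X : Matrix m n ℂ) :
    ‖(1 : Matrix (Fin r) (Fin r) ℂ) ⊗ₖ X‖ ≤ ‖X‖ := by
  convert norm_direct_sum_le (Equiv.refl (Fin r × m)) (Equiv.refl (Fin r × n)) X using 2
  ext x y
  simp only [Matrix.kroneckerMap_apply, Matrix.one_apply, Matrix.of_apply, Equiv.refl_apply,
    ite_mul, one_mul, zero_mul]
  congr

/-- Take `x = X y` in the hypothesis and cancel one factor `‖X y‖`. -/
theorem norm_le_of_bilinear_le {X : Matrix n n ℂ} {c : ℝ} (hc : 0 ≤ c)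
    (h : ∀ x y : EuclideanSpace ℂ n, ‖inner ℂ x (Matrix.toEuclideanCLM (𝕜 := ℂ) X y)‖ ≤
      c * (‖x‖ * ‖y‖)) : ‖X‖ ≤ c := by
  rw [Matrix.cstar_norm_def]
  refine ContinuousLinearMap.opNorm_le_bound _ hc fun y => ?_
  have := h (Matrix.toEuclideanCLM (𝕜 := ℂ) X y) y
  rw [inner_self_eq_norm_sq_to_K, norm_pow, RCLike.norm_ofReal, abs_norm] at this
  rcases eq_or_lt_of_le (norm_nonneg (Matrix.toEuclideanCLM (𝕜 := ℂ) X y)) with h0 | h0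
  · rw [← h0]; positivity
  · nlinarith

theorem norm_vecMulVec_star_le (x y : EuclideanSpace ℂ n) :
    ‖Matrix.vecMulVec (y : n → ℂ) (star (x : n → ℂ))‖ ≤ ‖x‖ * ‖y‖ := by
  refine norm_le_of_mulVec_le (by positivity) fun v => ?_
  have h : ∀ i, (Matrix.vecMulVec (y : n → ℂ) (star (x : n → ℂ)) *ᵥ v) i =
      y i * inner ℂ x (WithLp.toLp 2 v) := by
    intro i
    simp only [Matrix.mulVec, dotProduct, Matrix.vecMulVec_apply, PiLp.inner_apply,
      RCLike.inner_apply, Finset.mul_sum, Pi.star_apply]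
    exact Finset.sum_congr rfl fun j _ => by
      rw [mul_assoc]
      congr 1
      rw [mul_comm]; rfl
  simp only [h, norm_mul, mul_pow]
  rw [← Finset.sum_mul, ← EuclideanSpace.norm_sq_eq]
  have h1 := norm_inner_le_norm (𝕜 := ℂ) x (WithLp.toLp 2 v)
  have h2 : ∑ j, ‖v j‖ ^ 2 = ‖(WithLp.toLp 2 v : EuclideanSpace ℂ n)‖ ^ 2 := by
    rw [EuclideanSpace.norm_sq_eq]
  rw [h2]
  have h3 := pow_le_pow_left₀ (norm_nonneg _) h1 2
  rw [mul_pow] at h3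
  nlinarith [sq_nonneg ‖y‖]

/-- The trace is the sum of `⟨e, X e⟩` over the columns `e` of `E`, and the squared norms of the
columns add up to the trace of `Eᴴ * E`. This is the duality of trace norm and operator norm, for a
positive operator given in factored form. -/
theorem norm_trace_mul_mul_conjTranspose_le (X : Matrix n n ℂ) (E : Matrix n k ℂ) :
    ‖(X * (E * Eᴴ)).trace‖ ≤ ‖X‖ * (Eᴴ * E).trace.re := by
  have h1 : (X * (E * Eᴴ)).trace = ∑ i : k, inner ℂ (WithLp.toLp 2 (E.col i) : EuclideanSpace ℂ n)
      (Matrix.toEuclideanCLM (𝕜 := ℂ) X (WithLp.toLp 2 (E.col i))) := by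
    rw [← Matrix.mul_assoc, Matrix.trace_mul_comm, Matrix.trace]
    refine Finset.sum_congr rfl fun i _ => ?_
    rw [Matrix.diag_apply, Matrix.toEuclideanCLM_toLp, EuclideanSpace.inner_toLp_toLp,
      dotProduct_comm, Matrix.mul_apply]
    rfl
  have h2 : (Eᴴ * E).trace.re =
      ∑ i : k, ‖(WithLp.toLp 2 (E.col i) : EuclideanSpace ℂ n)‖ ^ 2 := by
    rw [Matrix.trace, Complex.re_sum]
    refine Finset.sum_congr rfl fun i _ => ?_
    rw [EuclideanSpace.norm_sq_eq, Matrix.diag_apply, Matrix.mul_apply, Complex.re_sum]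
    refine Finset.sum_congr rfl fun j _ => ?_
    rw [Matrix.conjTranspose_apply, ← Complex.normSq_eq_norm_sq]
    simp [Complex.normSq_apply, Complex.mul_re]
  rw [h1, h2, Finset.mul_sum]
  refine (norm_sum_le _ _).trans (Finset.sum_le_sum fun i _ => ?_)
  refine (norm_inner_le_norm _ _).trans ?_
  have := (Matrix.toEuclideanCLM (𝕜 := ℂ) X).le_opNorm (WithLp.toLp 2 (E.col i))
  rw [Matrix.l2_opNorm_toEuclideanCLM] at this
  nlinarith [norm_nonneg (WithLp.toLp 2 (E.col i) : EuclideanSpace ℂ n)]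

open scoped ComplexOrder MatrixOrder in
theorem exists_eq_conjTranspose_mul_self {X : Matrix n n ℂ} (h : X.PosSemidef) :
    ∃ B : Matrix n n ℂ, X = Bᴴ * B :=
  CStarAlgebra.nonneg_iff_eq_star_mul_self.1 h.nonneg

end OperatorNorm

/-! ### From channels on observables to outputs on density matrices. -/

section Duality

variable {Q N b : ℕ}

/-- The isometry `ℂ^Q ⊗ ℂ^N → (ℂ²)^{⊗ SysWire}` that writes labels in binary. -/
noncomputable def encodeMatrix (Q N : ℕ) : Matrix (SysWire Q N → Bool) (Fin Q × Fin N) ℂ :=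
  Matrix.of fun x p => if x = sysLabel p then 1 else 0

theorem encode_eq {r : ℕ} (σ : Matrix (Fin r × (Fin Q × Fin N)) (Fin r × (Fin Q × Fin N)) ℂ) :
    encode σ = ((1 : Matrix (Fin r) (Fin r) ℂ) ⊗ₖ encodeMatrix Q N) * σ *
      ((1 : Matrix (Fin r) (Fin r) ℂ) ⊗ₖ encodeMatrix Q N)ᴴ := rfl

theorem ofBits_label {n j : ℕ} (h : j < n) : Nat.ofBits (label (width n) j) = j := by
  unfold label
  rw [Nat.ofBits_testBit]
  exact Nat.mod_eq_of_lt (h.trans_le (Nat.le_pow_clog (by norm_num) n))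

theorem label_ofBits {m : ℕ} (x : Fin m → Bool) : label m (Nat.ofBits x) = x := by
  funext i
  simp [label]

theorem sysLabel_injective : Function.Injective (sysLabel : Fin Q × Fin N → SysWire Q N → Bool) := by
  rintro ⟨q, j⟩ ⟨q', j'⟩ h
  have h1 : label (width Q) q = label (width Q) q' := funext fun i => congrFun h (.inl i)
  have h2 : label (width N) j = label (width N) j' := funext fun i => congrFun h (.inr i)
  have h3 := congrArg Nat.ofBits h1
  have h4 := congrArg Nat.ofBits h2
  rw [ofBits_label q.2, ofBits_label q'.2] at h3
  rw [ofBits_label j.2, ofBits_label j'.2] at h4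
  exact Prod.ext (Fin.ext h3) (Fin.ext h4)

theorem encodeMatrix_conjTranspose_mul_self : (encodeMatrix Q N)ᴴ * encodeMatrix Q N = 1 := by
  ext p p'
  simp [Matrix.mul_apply, encodeMatrix, Matrix.one_apply, sysLabel_injective.eq_iff, eq_comm]

theorem adjoinZeros_eq {r a : ℕ} {S : Type} [Fintype S] [DecidableEq S]
    (ω : Matrix (Fin r × (S → Bool)) (Fin r × (S → Bool)) ℂ)
    (J : Matrix (S ⊕ Fin a → Bool) (S → Bool) ℂ)
    (hJ : J = Matrix.of fun u y => if u = Sum.elim y (fun _ => false) then 1 else 0) :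
    adjoinZeros ω = ((1 : Matrix (Fin r) (Fin r) ℂ) ⊗ₖ J) * ω *
      ((1 : Matrix (Fin r) (Fin r) ℂ) ⊗ₖ J)ᴴ := by
  have key : ∀ (x : S ⊕ Fin a → Bool) (y : S → Bool), x = Sum.elim y (fun _ => false) ↔
      (∀ i, x (.inr i) = false) ∧ (fun w => x (.inl w)) = y := by
    intro x y
    constructor
    · rintro rfl
      simp
    · rintro ⟨h1, rfl⟩
      funext i
      rcases i with i | i <;> simp [h1]
  ext ⟨i, x⟩ ⟨j, y⟩
  subst hJ
  simp only [adjoinZeros, Matrix.of_apply, Matrix.mul_apply, Matrix.conjTranspose_apply,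
    Matrix.kroneckerMap_apply, Matrix.one_apply, key, Fintype.sum_prod_type]
  by_cases h1 : ∀ i, x (.inr i) = false <;> by_cases h2 : ∀ i, y (.inr i) = false <;>
    simp [h1, h2, apply_ite (starRingEnd ℂ)]

/-- The output of a circuit in terms of its Kraus operators. -/
theorem output_eq_sum (c : Circuit Q N b) (Z : Table Q N b) {r : ℕ}
    (σ : Matrix (Fin r × (Fin Q × Fin N)) (Fin r × (Fin Q × Fin N)) ℂ) :
    c.output Z σ = ∑ z : Fin c.ancillas → Bool,
      ((1 : Matrix (Fin r) (Fin r) ℂ) ⊗ₖ krausOp (listMatrix Z c.gates) z) * encode σ *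
        ((1 : Matrix (Fin r) (Fin r) ℂ) ⊗ₖ krausOp (listMatrix Z c.gates) z)ᴴ := by
  set J : Matrix (SysWire Q N ⊕ Fin c.ancillas → Bool) (SysWire Q N → Bool) ℂ :=
    Matrix.of fun u y => if u = Sum.elim y (fun _ => false) then 1 else 0 with hJ
  have hK : ∀ z : Fin c.ancillas → Bool,
      (1 : Matrix (Fin r) (Fin r) ℂ) ⊗ₖ krausOp (listMatrix Z c.gates) z =
        (((1 : Matrix (Fin r) (Fin r) ℂ) ⊗ₖ listMatrix Z c.gates) *
          ((1 : Matrix (Fin r) (Fin r) ℂ) ⊗ₖ J)).submatrix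
            (fun x => (x.1, Sum.elim x.2 z)) id := by
    intro z
    rw [← Matrix.mul_kronecker_mul, one_mul]
    ext ⟨i, x⟩ ⟨j, y⟩
    simp [Matrix.kroneckerMap_apply, krausOp, Matrix.mul_apply, hJ]
  simp only [Circuit.output]
  rw [adjoinZeros_eq (encode σ) J hJ]
  ext x y
  rw [Matrix.sum_apply]
  simp only [traceAncillas, Matrix.of_apply]
  refine Finset.sum_congr rfl fun z _ => ?_
  have hm : ∀ (V : Matrix (Fin r × (SysWire Q N ⊕ Fin c.ancillas → Bool))
      (Fin r × (SysWire Q N ⊕ Fin c.ancillas → Bool)) ℂ)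
      (H : Matrix (Fin r × (SysWire Q N ⊕ Fin c.ancillas → Bool))
      (Fin r × (SysWire Q N → Bool)) ℂ)
      (ω : Matrix (Fin r × (SysWire Q N → Bool)) (Fin r × (SysWire Q N → Bool)) ℂ), V * (H * ω * Hᴴ) * Vᴴ = (V * H) * ω * (V * H)ᴴ := by
    intro V H ω
    rw [Matrix.conjTranspose_mul]
    simp only [Matrix.mul_assoc]
  rw [hm, hK z]
  simp only [Matrix.mul_apply, Matrix.submatrix_apply, Matrix.conjTranspose_apply, id]

open scoped Matrix.Norms.L2Operator in
/-- It suffices to compare the channels in the Heisenberg picture, where the operator norm is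
contracted. -/
theorem simulates_of_dualChannel {c : Circuit Q N b} {Z : Table Q N b} {ε : ℝ} (hε : 0 ≤ ε)
    {U : Matrix (Fin Q × Fin N) (Fin Q × Fin N) ℂ}
    {V : Matrix (SysWire Q N → Bool) (SysWire Q N → Bool) ℂ}
    (hV : V * encodeMatrix Q N = encodeMatrix Q N * U)
    (h : ∀ (r : ℕ) (O : Matrix (Fin r × (SysWire Q N → Bool)) (Fin r × (SysWire Q N → Bool)) ℂ),
      ‖dualChannel (listMatrix Z c.gates) O - ((1 : Matrix (Fin r) (Fin r) ℂ) ⊗ₖ V)ᴴ * O *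
        ((1 : Matrix (Fin r) (Fin r) ℂ) ⊗ₖ V)‖ ≤ ε * ‖O‖) :
    c.Simulates Z U ε := by
  intro r σ hσ htr
  obtain ⟨B, hB⟩ := exists_eq_conjTranspose_mul_self hσ
  have hω : encode (((1 : Matrix (Fin r) (Fin r) ℂ) ⊗ₖ U) * σ *
      ((1 : Matrix (Fin r) (Fin r) ℂ) ⊗ₖ U)ᴴ) =
      ((1 : Matrix (Fin r) (Fin r) ℂ) ⊗ₖ V) * encode σ *
        ((1 : Matrix (Fin r) (Fin r) ℂ) ⊗ₖ V)ᴴ := by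
    have e : ((1 : Matrix (Fin r) (Fin r) ℂ) ⊗ₖ V) *
        ((1 : Matrix (Fin r) (Fin r) ℂ) ⊗ₖ encodeMatrix Q N) =
        ((1 : Matrix (Fin r) (Fin r) ℂ) ⊗ₖ encodeMatrix Q N) *
          ((1 : Matrix (Fin r) (Fin r) ℂ) ⊗ₖ U) := by
      rw [← Matrix.mul_kronecker_mul, ← Matrix.mul_kronecker_mul, hV]
    have e' := congrArg Matrix.conjTranspose e
    rw [Matrix.conjTranspose_mul, Matrix.conjTranspose_mul] at e'
    rw [encode_eq, encode_eq]
    simp only [Matrix.mul_assoc, e']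
    rw [← Matrix.mul_assoc (1 ⊗ₖ V), e]
    simp only [Matrix.mul_assoc]
  -- A square root of the encoded state: `E * Eᴴ` is `encode σ`, and `Eᴴ * E` has trace one because
  -- the encoding is isometric.
  set E := ((1 : Matrix (Fin r) (Fin r) ℂ) ⊗ₖ encodeMatrix Q N) * Bᴴ with hE
  have hEE : encode σ = E * Eᴴ := by
    rw [encode_eq, hE, hB, Matrix.conjTranspose_mul, Matrix.conjTranspose_conjTranspose]
    simp only [Matrix.mul_assoc]
  have htrE : (Eᴴ * E).trace = 1 := by
    rw [hE, Matrix.conjTranspose_mul, Matrix.conjTranspose_conjTranspose, Matrix.mul_assoc,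
      ← Matrix.mul_assoc (((1 : Matrix (Fin r) (Fin r) ℂ) ⊗ₖ encodeMatrix Q N)ᴴ),
      Matrix.conjTranspose_kronecker, ← Matrix.mul_kronecker_mul,
      encodeMatrix_conjTranspose_mul_self, Matrix.conjTranspose_one, one_mul,
      Matrix.one_kronecker_one, one_mul, Matrix.trace_mul_comm]
    rw [hB] at htr
    exact htr
  rw [hω, output_eq_sum]
  unfold spectralNorm
  refine norm_le_of_bilinear_le hε fun x y => ?_
  -- The form `⟨x, X y⟩` is the trace of `O * X` for this rank-one observable, whose norm is at most
  -- `‖x‖ * ‖y‖`.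
  set O := Matrix.vecMulVec (y : _ → ℂ) (star (x : _ → ℂ)) with hO
  set L := listMatrix Z c.gates
  have key : inner ℂ x (Matrix.toEuclideanCLM (𝕜 := ℂ) (∑ z : Fin c.ancillas → Bool,
      ((1 : Matrix (Fin r) (Fin r) ℂ) ⊗ₖ krausOp L z) * encode σ *
        ((1 : Matrix (Fin r) (Fin r) ℂ) ⊗ₖ krausOp L z)ᴴ -
        ((1 : Matrix (Fin r) (Fin r) ℂ) ⊗ₖ V) * encode σ *
        ((1 : Matrix (Fin r) (Fin r) ℂ) ⊗ₖ V)ᴴ) y) =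
      ((dualChannel L O - ((1 : Matrix (Fin r) (Fin r) ℂ) ⊗ₖ V)ᴴ * O *
        ((1 : Matrix (Fin r) (Fin r) ℂ) ⊗ₖ V)) * (E * Eᴴ)).trace := by
    rw [← hEE]
    have hin : ∀ X : Matrix (Fin r × (SysWire Q N → Bool)) (Fin r × (SysWire Q N → Bool)) ℂ,
        inner ℂ x (Matrix.toEuclideanCLM (𝕜 := ℂ) X y) = (O * X).trace := by
      intro X
      rw [hO, Matrix.trace_mul_comm, Matrix.mul_vecMulVec, Matrix.trace_vecMulVec]
      rfl
    have hc : ∀ K : Matrix (SysWire Q N → Bool) (SysWire Q N → Bool) ℂ,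
        (O * (((1 : Matrix (Fin r) (Fin r) ℂ) ⊗ₖ K) * encode σ *
          ((1 : Matrix (Fin r) (Fin r) ℂ) ⊗ₖ K)ᴴ)).trace =
        (((1 : Matrix (Fin r) (Fin r) ℂ) ⊗ₖ K)ᴴ * O * ((1 : Matrix (Fin r) (Fin r) ℂ) ⊗ₖ K) *
          encode σ).trace := by
      intro K
      rw [← Matrix.mul_assoc, Matrix.trace_mul_comm]
      simp only [Matrix.mul_assoc]
    rw [hin, Matrix.mul_sub, Matrix.trace_sub, hc, Matrix.mul_sum, Matrix.trace_sum, Matrix.sub_mul,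
      Matrix.trace_sub, dualChannel, Matrix.sum_mul, Matrix.trace_sum]
    simp only [hc]
  rw [key]
  refine (norm_trace_mul_mul_conjTranspose_le _ _).trans ?_
  rw [htrE, Complex.one_re, mul_one]
  exact (h r O).trans (mul_le_mul_of_nonneg_left (norm_vecMulVec_star_le x y) hε)

end Duality

/-! ### Basis permutations and direct sums of plane rotations. -/

section FunMatrix

variable {Ω : Type*} [DecidableEq Ω]

/-- The matrix that maps the basis state `y` to the basis state `F y`. -/
def funMatrix (F : Ω → Ω) : Matrix Ω Ω ℂ := Matrix.of fun x y => if x = F y then 1 else 0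

theorem funMatrix_id : funMatrix (id : Ω → Ω) = 1 := by
  ext x y
  simp [funMatrix, Matrix.one_apply]

variable [Fintype Ω]

theorem funMatrix_mul (F G : Ω → Ω) : funMatrix F * funMatrix G = funMatrix (F ∘ G) := by
  ext x y
  simp [funMatrix, Matrix.mul_apply]

theorem funMatrix_mul_diagonal {F G : Ω → Ω} (hFG : Function.LeftInverse G F)
    (g : Ω → ℂ) : funMatrix F * Matrix.diagonal g = Matrix.diagonal (g ∘ G) * funMatrix F := by
  ext x y
  rw [Matrix.mul_diagonal, Matrix.diagonal_mul]
  by_cases h : x = F y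
  · simp [funMatrix, h, hFG y]
  · simp [funMatrix, h]

open scoped Matrix.Norms.L2Operator in
theorem norm_funMatrix_le {F : Ω → Ω} (hF : Function.Injective F) : ‖funMatrix F‖ ≤ 1 := by
  have h : (funMatrix F)ᴴ * funMatrix F = 1 := by
    ext x y
    simp [funMatrix, Matrix.mul_apply, Matrix.one_apply, hF.eq_iff, eq_comm]
  have h2 := Matrix.l2_opNorm_conjTranspose_mul_self (funMatrix F)
  have h3 : ‖(1 : Matrix Ω Ω ℂ)‖ ≤ 1 := by
    rw [← Matrix.diagonal_one, Matrix.l2_opNorm_diagonal]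
    exact (pi_norm_le_iff_of_nonneg zero_le_one).2 fun i => by simp
  rw [h] at h2
  nlinarith [norm_nonneg (funMatrix F)]

/-- A direct sum of rotations about an axis `p` of the equatorial plane, of the pairs of basis states
that are exchanged by `F`; the bit `a` tells the two states of a pair apart. -/
noncomputable def rotMatrix (F : Ω → Ω) (a : Ω → Bool) (p : Bool → ℂ) (θ : Ω → ℝ) : Matrix Ω Ω ℂ :=
  Matrix.diagonal (fun y => (Real.cos (θ y) : ℂ)) +
    Matrix.diagonal (fun y => p (a y) * (Real.sin (θ y) : ℂ)) * funMatrix F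

theorem rotMatrix_zero (F : Ω → Ω) (a : Ω → Bool) (p : Bool → ℂ) :
    rotMatrix F a p (fun _ => 0) = 1 := by
  simp [rotMatrix]

/-- On each pair exchanged by `F` both factors are rotations about one axis, so the angles add. This
needs the second angle to be constant on pairs and the off-diagonal part to square to `-1`. -/
theorem rotMatrix_mul {F : Ω → Ω} (hF : Function.Involutive F) {a : Ω → Bool}
    (ha : ∀ y, a (F y) = !a y) {p : Bool → ℂ} (hp : ∀ c, p c * p (!c) = -1) {θ θ' : Ω → ℝ}
    (h' : ∀ y, θ' (F y) = θ' y) :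
    rotMatrix F a p θ * rotMatrix F a p θ' = rotMatrix F a p (fun y => θ y + θ' y) := by
  have e : ∀ y, p (a y) * p (a (F y)) = -1 := fun y => by rw [ha]; exact hp _
  simp only [rotMatrix]
  rw [Matrix.add_mul, Matrix.mul_add, Matrix.mul_add, Matrix.diagonal_mul_diagonal,
    ← Matrix.mul_assoc, Matrix.diagonal_mul_diagonal, Matrix.mul_assoc,
    funMatrix_mul_diagonal hF, Matrix.mul_assoc, ← Matrix.mul_assoc (funMatrix F),
    funMatrix_mul_diagonal hF, Matrix.mul_assoc _ (funMatrix F), funMatrix_mul, hF.comp_self,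
    funMatrix_id, mul_one, ← Matrix.mul_assoc, Matrix.diagonal_mul_diagonal,
    Matrix.diagonal_mul_diagonal, add_add_add_comm, add_comm (Matrix.diagonal _ * funMatrix F),
    ← add_assoc, add_right_comm (Matrix.diagonal _) (_ * _) (Matrix.diagonal _),
    Matrix.diagonal_add, add_assoc, ← Matrix.add_mul, Matrix.diagonal_add]
  congr 2
  · funext y
    simp only [Function.comp_apply, h', Real.cos_add]
    rw [Complex.ofReal_sub, Complex.ofReal_mul, Complex.ofReal_mul]
    linear_combination (Real.sin (θ y) * Real.sin (θ' y) : ℂ) * e y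
  · congr 1
    funext y
    simp only [Function.comp_apply, h', Real.sin_add]
    push_cast
    ring

/-- Conjugation by a permutation relabels the pairs. It turns rotations of the flag qubit into
rotations of the states that the matrix entries couple. -/
theorem funMatrix_conj_rotMatrix {F B B' : Ω → Ω} (h₁ : Function.LeftInverse B' B)
    (h₂ : Function.RightInverse B' B) {a : Ω → Bool} (ha : ∀ y, a (B y) = a y) (p : Bool → ℂ)
    (θ : Ω → ℝ) :
    funMatrix B' * rotMatrix F a p θ * funMatrix B = rotMatrix (B' ∘ F ∘ B) a p (θ ∘ B) := by
  simp only [rotMatrix]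
  rw [Matrix.mul_add, Matrix.add_mul, ← Matrix.mul_assoc, funMatrix_mul_diagonal h₂,
    funMatrix_mul_diagonal h₂, Matrix.mul_assoc, Matrix.mul_assoc, Matrix.mul_assoc, funMatrix_mul,
    funMatrix_mul, funMatrix_mul, h₁.comp_eq_id, funMatrix_id, mul_one]
  simp only [Function.comp_def, ha]

end FunMatrix

/-! ### Matrices of elementary gates and of lists of such gates. -/

section Gates

variable {Q N b : ℕ} {W : Type} [DecidableEq W]

theorem eq_update_not_iff {x y : W → Bool} {t : W} :
    x = Function.update y t (!y t) ↔ (∀ i, i ≠ t → x i = y i) ∧ x t ≠ y t := by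
  rw [Function.eq_update_iff]
  cases x t <;> cases y t <;> simp

theorem eq_iff_off_and_at {x y : W → Bool} {t : W} :
    x = y ↔ (∀ i, i ≠ t → x i = y i) ∧ x t = y t := by
  refine ⟨fun e => e ▸ ⟨fun _ _ => rfl, rfl⟩, fun e => funext fun i => ?_⟩
  by_cases hi : i = t
  · rw [hi, e.2]
  · exact e.1 i hi

variable [Fintype W]

/-- The one-qubit gate `NOT`. -/
def notUnitary : Matrix.unitaryGroup Bool ℂ :=
  ⟨Matrix.of fun a c => if a = c then 0 else 1, by
    rw [Matrix.mem_unitaryGroup_iff]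
    ext a c
    cases a <;> cases c <;> simp [Matrix.mul_apply, Matrix.star_apply]⟩

/-- The Hadamard gate. -/
noncomputable def hadamardUnitary : Matrix.unitaryGroup Bool ℂ :=
  ⟨Matrix.of fun a c => ((√2)⁻¹ : ℝ) * if a && c then -1 else 1, by
    have h : ((√2 : ℝ) : ℂ) * (√2 : ℝ) = 2 := by
      rw [← Complex.ofReal_mul, Real.mul_self_sqrt (by norm_num)]
      norm_num
    have h0 : ((√2 : ℝ) : ℂ) ≠ 0 := by
      norm_cast
      positivity
    rw [Matrix.mem_unitaryGroup_iff]
    ext a c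
    cases a <;> cases c <;> simp [Matrix.mul_apply, Matrix.star_apply] <;> field_simp <;>
      first | linear_combination h | linear_combination -h⟩

/-- The unit vector `p` describes an axis in the equatorial plane of the Bloch sphere. -/
def IsAxis (p : Bool → ℂ) : Prop := ∀ c, p c * p (!c) = -1 ∧ star (p c) = -p (!c)

/-- The rotation by the angle `2 θ` about the axis `p`. -/
noncomputable def rotUnitary (p : Bool → ℂ) (hp : IsAxis p) (θ : ℝ) :
    Matrix.unitaryGroup Bool ℂ :=
  ⟨Matrix.of fun a c => if a = c then (Real.cos θ : ℂ) else p a * (Real.sin θ : ℂ), by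
    have h : (Real.cos θ : ℂ) ^ 2 + (Real.sin θ : ℂ) ^ 2 = 1 := by
      norm_cast
      exact Real.cos_sq_add_sin_sq θ
    have h1 := (hp false).1
    have h2 := (hp false).2
    have h3 := (hp true).2
    simp only [Bool.not_false, Bool.not_true, RCLike.star_def] at h1 h2 h3
    rw [Matrix.mem_unitaryGroup_iff]
    ext a c
    cases a <;> cases c <;>
      simp only [Matrix.mul_apply, Matrix.star_apply, Fintype.sum_bool, Matrix.of_apply,
        Matrix.one_apply, RCLike.star_def, reduceCtorEq, if_true, if_false, map_mul,
        Complex.conj_ofReal, h2, h3] <;>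
      first
        | linear_combination h - (Real.sin θ : ℂ) ^ 2 * h1
        | ring⟩

/-- The target is not a control, so the controls may be read from the input `y` instead of the
output; in this form gates can be followed along basis states. -/
theorem toMatrix_elementary_apply (Z : Table Q N b) (s : Finset W) (hs : s.card ≤ 2) (t : W)
    (ht : t ∉ s) (U : Matrix.unitaryGroup Bool ℂ) (x y : W → Bool) :
    (Gate.elementary s hs t ht U : Gate Q N b W).toMatrix Z x y =
      if ∀ i, i ≠ t → x i = y i then
        if ∀ i ∈ s, y i = true then (U : Matrix Bool Bool ℂ) (x t) (y t)
        else if x t = y t then 1 else 0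
      else 0 := by
  simp only [Gate.toMatrix, Matrix.of_apply]
  by_cases h : ∀ i, i ≠ t → x i = y i
  · have h1 : (∀ i ∈ s, x i = true) ↔ ∀ i ∈ s, y i = true :=
      forall₂_congr fun i hi => by rw [h i fun e => ht (e ▸ hi)]
    have h2 : x = y ↔ x t = y t := by
      refine ⟨fun e => e ▸ rfl, fun e => funext fun i => ?_⟩
      by_cases hi : i = t
      · rw [hi, e]
      · exact h i hi
    simp only [if_pos h, h1, h2]
  · have h2 : x ≠ y := fun e => h fun i _ => e ▸ rfl
    simp [if_neg h, h2]

theorem toMatrix_not (Z : Table Q N b) (s : Finset W) (hs : s.card ≤ 2) (t : W) (ht : t ∉ s) :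
    (Gate.elementary s hs t ht notUnitary : Gate Q N b W).toMatrix Z =
      funMatrix fun y => if ∀ i ∈ s, y i = true then Function.update y t (!y t) else y := by
  ext x y
  rw [toMatrix_elementary_apply]
  by_cases h : ∀ i ∈ s, y i = true
  · rw [funMatrix, Matrix.of_apply, if_pos h, if_pos h]
    simp only [notUnitary, Matrix.of_apply, eq_update_not_iff, ite_and, ne_eq, ite_not]
  · rw [funMatrix, Matrix.of_apply, if_neg h, if_neg h]
    simp only [eq_iff_off_and_at (x := x) (t := t), ite_and]

/-- A list of controlled `NOT` gates whose targets are distinct and are no controls. -/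
theorem listMatrix_map_not (Z : Table Q N b) {ι : Type*} [DecidableEq ι] (s : ι → Finset W)
    (hs : ∀ i, (s i).card ≤ 2) (t : ι → W) (ht : ∀ i j, t i ∉ s j) (hinj : Function.Injective t)
    (l : List ι) (hl : l.Nodup) :
    listMatrix Z (l.map fun i =>
      (Gate.elementary (s i) (hs i) (t i) (ht i i) notUnitary : Gate Q N b W)) =
      funMatrix fun y w => xor (y w) (decide (∃ i ∈ l, w = t i ∧ ∀ v ∈ s i, y v = true)) := by
  induction l with
  | nil => simp [listMatrix, ← funMatrix_id, Function.id_def]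
  | cons i l ih =>
    rw [List.nodup_cons] at hl
    rw [List.map_cons, listMatrix, ih hl.2, toMatrix_not, funMatrix_mul]
    congr 1
    funext y w
    have hsame : ∀ j, (∀ v ∈ s j, (if ∀ v ∈ s i, y v = true then
        Function.update y (t i) (!y (t i)) else y) v = true) ↔ ∀ v ∈ s j, y v = true := by
      intro j
      refine forall₂_congr fun v hv => ?_
      split_ifs
      · have hne : v ≠ t i := fun e => ht i j (e ▸ hv)
        rw [Function.update_of_ne hne]
      · rfl
    simp only [Function.comp_apply, hsame]
    by_cases hw : w = t i
    · subst hw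
      have h1 : ¬ ∃ j ∈ l, t i = t j ∧ ∀ v ∈ s j, y v = true := by
        rintro ⟨j, hj, e, -⟩
        exact hl.1 (hinj e ▸ hj)
      have h2 : (∃ j ∈ i :: l, t i = t j ∧ ∀ v ∈ s j, y v = true) ↔ ∀ v ∈ s i, y v = true := by
        constructor
        · rintro ⟨j, -, e, h⟩
          rwa [hinj e]
        · exact fun h => ⟨i, by simp, rfl, h⟩
      simp only [h1, h2]
      split_ifs with h
      · rw [Function.update_self, decide_eq_true h]
        simp
      · rw [decide_eq_false h]
        simp
    · have h1 : (if ∀ v ∈ s i, y v = true then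
        Function.update y (t i) (!y (t i)) else y) w = y w := by
        split_ifs
        · rw [Function.update_of_ne hw]
        · rfl
      rw [h1]
      simp [hw]

theorem toMatrix_rot (Z : Table Q N b) {p : Bool → ℂ} (hp : IsAxis p) (θ : ℝ) (v t : W)
    (hs : ({v} : Finset W).card ≤ 2) (ht : t ∉ ({v} : Finset W)) :
    (Gate.elementary {v} hs t ht (rotUnitary p hp θ) : Gate Q N b W).toMatrix Z =
      rotMatrix (fun y => Function.update y t (!y t)) (fun y => y t) p
        (fun y => if y v = true then θ else 0) := by
  ext x y
  have htv : v ≠ t := fun e => ht (by simp [e])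
  rw [toMatrix_elementary_apply, rotMatrix, Matrix.add_apply, Matrix.diagonal_mul,
    Matrix.diagonal_apply]
  simp only [funMatrix, Matrix.of_apply, eq_update_not_iff, eq_iff_off_and_at (x := x) (t := t),
    Finset.mem_singleton, forall_eq, rotUnitary]
  by_cases h : ∀ i, i ≠ t → x i = y i
  · rw [h v htv]
    by_cases h2 : x t = y t <;> by_cases h3 : y v = true <;> simp [h2, h3]
  · simp [h]

/-- Rotations of one target about one axis add their angles, and none of them changes a control.
Controlled by the digits of a word, they rotate by the number that the word represents, without any
arithmetic on it. -/
theorem listMatrix_map_rot (Z : Table Q N b) {p : Bool → ℂ} (hp : IsAxis p) {ι : Type*}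
    (θ : ι → ℝ) (v : ι → W) (t : W) (hs : ∀ i, ({v i} : Finset W).card ≤ 2)
    (ht : ∀ i, t ∉ ({v i} : Finset W)) (l : List ι) :
    listMatrix Z (l.map fun i =>
      (Gate.elementary {v i} (hs i) t (ht i) (rotUnitary p hp (θ i)) : Gate Q N b W)) =
      rotMatrix (fun y => Function.update y t (!y t)) (fun y => y t) p
        (fun y => (l.map fun i => if y (v i) = true then θ i else 0).sum) := by
  induction l with
  | nil => simp [listMatrix, rotMatrix_zero]
  | cons i l ih =>
    have hF : Function.Involutive fun y : W → Bool => Function.update y t (!y t) := by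
      intro y
      simp
    rw [List.map_cons, listMatrix, ih, toMatrix_rot, rotMatrix_mul hF _ (fun c => (hp c).1)]
    · simp only [List.map_cons, List.sum_cons, add_comm]
    · intro y
      have : v i ≠ t := fun e => ht i (by simp [e])
      simp [Function.update_of_ne this]
    · intro y
      simp

/-- Only the columns with zeros on the targets are needed. There no sign occurs, and each gate
contributes one factor `(√2)⁻¹`. -/
theorem listMatrix_map_hadamard (Z : Table Q N b) {ι : Type*} (t : ι → W)
    (hs : (∅ : Finset W).card ≤ 2) (ht : ∀ i, t i ∉ (∅ : Finset W)) (hinj : Function.Injective t)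
    (l : List ι) (hl : l.Nodup) (x y : W → Bool) (hy : ∀ i ∈ l, y (t i) = false) :
    listMatrix Z (l.map fun i =>
      (Gate.elementary ∅ hs (t i) (ht i) hadamardUnitary : Gate Q N b W)) x y =
      if ∀ w, (∀ i ∈ l, w ≠ t i) → x w = y w then (((√2)⁻¹ : ℝ) : ℂ) ^ l.length else 0 := by
  induction l generalizing y with
  | nil => simp [listMatrix, Matrix.one_apply, funext_iff]
  | cons i l ih =>
    rw [List.nodup_cons] at hl
    have hyi := hy i (by simp)
    have hne : ∀ j ∈ l, t j ≠ t i := fun j hj e => hl.1 (hinj e ▸ hj)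
    have hval : ∀ u, (Gate.elementary ∅ hs (t i) (ht i) hadamardUnitary : Gate Q N b W).toMatrix Z
        u y = if ∃ a, u = Function.update y (t i) a then (((√2)⁻¹ : ℝ) : ℂ) else 0 := by
      intro u
      have e : (∃ a, u = Function.update y (t i) a) ↔ ∀ w, w ≠ t i → u w = y w := by
        constructor
        · rintro ⟨a, rfl⟩ w hw
          rw [Function.update_of_ne hw]
        · intro h
          refine ⟨u (t i), ?_⟩
          rw [Function.eq_update_iff]
          exact ⟨rfl, h⟩
      rw [toMatrix_elementary_apply]
      simp [e, hyi, hadamardUnitary]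
    rw [List.map_cons, listMatrix, Matrix.mul_apply]
    have hsum : ∑ u, listMatrix Z (l.map fun i =>
        (Gate.elementary ∅ hs (t i) (ht i) hadamardUnitary : Gate Q N b W)) x u *
        (Gate.elementary ∅ hs (t i) (ht i) hadamardUnitary : Gate Q N b W).toMatrix Z u y =
        listMatrix Z (l.map fun i =>
        (Gate.elementary ∅ hs (t i) (ht i) hadamardUnitary : Gate Q N b W)) x
          (Function.update y (t i) (x (t i))) * (((√2)⁻¹ : ℝ) : ℂ) := by
      rw [Finset.sum_eq_single (Function.update y (t i) (x (t i)))]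
      · rw [hval, if_pos ⟨_, rfl⟩]
      · intro u _ hu
        rw [hval]
        split_ifs with h
        · obtain ⟨a, rfl⟩ := h
          rw [ih hl.2, if_neg, zero_mul]
          · intro h
            have := h (t i) fun j hj e => hl.1 (hinj e ▸ hj)
            rw [Function.update_self] at this
            exact hu (by rw [this])
          · intro j hj
            rw [Function.update_of_ne (hne j hj)]
            exact hy j (by simp [hj])
        · rw [mul_zero]
      · simp
    rw [hsum, ih hl.2]
    · have e : (∀ w, (∀ j ∈ l, w ≠ t j) → x w = Function.update y (t i) (x (t i)) w) ↔
          ∀ w, (∀ j ∈ i :: l, w ≠ t j) → x w = y w := by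
        refine forall_congr' fun w => ?_
        by_cases hw : w = t i
        · subst hw
          simp
        · simp [hw]
      simp only [e, List.length_cons, pow_succ, ite_mul, zero_mul]
    · intro j hj
      rw [Function.update_of_ne (hne j hj)]
      exact hy j (by simp [hj])

end Gates

/-! ### The circuit of one step and the unitary that it realizes. -/

section Step

variable {Q N b : ℕ}

/-- The ancillas of one step: a displacement of the row index, a flag, and the two words that receive
the output of the oracle. -/
abbrev StepAnc (N b : ℕ) : Type := (Fin (width N) ⊕ Unit) ⊕ (Fin (b + 1) ⊕ Fin (b + 1))

/-- The qubits of one step. -/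
abbrev StepWire (Q N b : ℕ) : Type := SysWire Q N ⊕ StepAnc N b

abbrev wBlock (i : Fin (width Q)) : StepWire Q N b := .inl (.inl i)
abbrev wRow (i : Fin (width N)) : StepWire Q N b := .inl (.inr i)
abbrev wCol (i : Fin (width N)) : StepWire Q N b := .inr (.inl (.inl i))
abbrev wFlag : StepWire Q N b := .inr (.inl (.inr ()))
abbrev wRe (i : Fin (b + 1)) : StepWire Q N b := .inr (.inr (.inl i))
abbrev wIm (i : Fin (b + 1)) : StepWire Q N b := .inr (.inr (.inr i))

/-- Add the displacement to the row index if the flag is set. -/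
def addRow (y : StepWire Q N b → Bool) : StepWire Q N b → Bool :=
  Sum.elim (Sum.elim (fun i => y (wBlock i)) fun i => xor (y (wRow i)) (y wFlag && y (wCol i)))
    fun w => y (.inr w)

/-- Add the row index to the displacement, which gives the column index. -/
def addCol (y : StepWire Q N b → Bool) : StepWire Q N b → Bool :=
  Sum.elim (fun w => y (.inl w))
    (Sum.elim (Sum.elim (fun i => xor (y (wCol i)) (y (wRow i))) fun _ => y wFlag)
      fun w => y (.inr (.inr w)))

/-- The action of the oracle on basis states. -/
def oracleMap (Z : Table Q N b) (y : StepWire Q N b → Bool) : StepWire Q N b → Bool :=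
  let s := Z.lookup (fun i => y (wBlock i)) (fun i => y (wRow i)) (fun i => y (wCol i))
  Sum.elim (fun w => y (.inl w)) (Sum.elim (fun w => y (.inr (.inl w)))
    (Sum.elim (fun i => xor (y (wRe i)) (s.1 i)) fun i => xor (y (wIm i)) (s.2 i)))

/-- Flip the flag. -/
def flipFlag (y : StepWire Q N b → Bool) : StepWire Q N b → Bool :=
  Function.update y wFlag (!y wFlag)

/-- Flip the flag and add the displacement to the row index. -/
def exchange (y : StepWire Q N b → Bool) : StepWire Q N b → Bool :=
  Sum.elim (Sum.elim (fun i => y (wBlock i)) fun i => xor (y (wRow i)) (y (wCol i)))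
    (Sum.elim (Sum.elim (fun i => y (wCol i)) fun _ => !y wFlag) fun w => y (.inr (.inr w)))

/-- The position of the address and output registers of the oracle. -/
def oraclePlace (Q N b : ℕ) : OracleWire Q N b ↪ StepWire Q N b where
  toFun
    | .block i => wBlock i
    | .row i => wRow i
    | .col i => wCol i
    | .re i => wRe i
    | .im i => wIm i
  inj' := by
    intro v w h
    cases v <;> cases w <;> simp_all

theorem addRow_involutive : Function.Involutive (addRow : (StepWire Q N b → Bool) → _) := by
  intro y
  funext w
  rcases w with (i | i) | ((i | i) | (i | i)) <;> simp [addRow]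

theorem addCol_involutive : Function.Involutive (addCol : (StepWire Q N b → Bool) → _) := by
  intro y
  funext w
  rcases w with (i | i) | ((i | i) | (i | i)) <;> simp [addCol]

theorem oracleMap_involutive (Z : Table Q N b) : Function.Involutive (oracleMap Z) := by
  intro y
  funext w
  rcases w with (i | i) | ((i | i) | (i | i)) <;> simp [oracleMap]

theorem flipFlag_inl (y : StepWire Q N b → Bool) (w : SysWire Q N) :
    flipFlag y (.inl w) = y (.inl w) := by simp [flipFlag]

theorem flipFlag_col (y : StepWire Q N b → Bool) (i : Fin (width N)) :
    flipFlag y (wCol i) = y (wCol i) := by simp [flipFlag]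

theorem flipFlag_flag (y : StepWire Q N b → Bool) :
    flipFlag y wFlag = !y wFlag := by simp [flipFlag]

theorem flipFlag_word (y : StepWire Q N b → Bool) (w : Fin (b + 1) ⊕ Fin (b + 1)) :
    flipFlag y (.inr (.inr w)) = y (.inr (.inr w)) := by simp [flipFlag]

/-- After `addRow` and `addCol`, the states with row `j`, flag `0` and with row `j ⊕ d`, flag `1`
both hold the address `(j, j ⊕ d)`, so the oracle reads the same word for both and only the flag
distinguishes them. One word thus fixes both entries of a two-by-two block, even if the table is not
exactly Hermitian. The flag also separates the two states when `d = 0`, where `j` is coupled to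
itself. -/
theorem exchange_eq (Z : Table Q N b) :
    (addRow ∘ addCol ∘ oracleMap Z) ∘ flipFlag ∘ (oracleMap Z ∘ addCol ∘ addRow) = exchange := by
  funext y w
  rcases w with (i | i) | ((i | i) | (i | i)) <;>
    simp [addRow, addCol, oracleMap, exchange, flipFlag_inl, flipFlag_col, flipFlag_flag,
      flipFlag_word]
  cases y wFlag <;> cases y (wCol i) <;> simp

theorem exchange_involutive : Function.Involutive (exchange : (StepWire Q N b → Bool) → _) := by
  intro y
  funext w
  rcases w with (i | i) | ((i | i) | (i | i)) <;> simp [exchange]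

theorem toMatrix_oraclePlace (Z : Table Q N b) :
    (Gate.oracle (oraclePlace Q N b)).toMatrix Z = funMatrix (oracleMap Z) := by
  ext x y
  simp only [Gate.toMatrix, Matrix.of_apply, funMatrix]
  congr 1
  apply propext
  constructor
  · rintro ⟨h₁, h₂, h₃⟩
    funext w
    rcases w with (i | i) | ((i | i) | (i | i))
    · exact h₃ (wBlock i) (fun _ h => by cases h) (fun _ h => by cases h)
    · exact h₃ (wRow i) (fun _ h => by cases h) (fun _ h => by cases h)
    · exact h₃ (wCol i) (fun _ h => by cases h) (fun _ h => by cases h)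
    · exact h₃ wFlag (fun _ h => by cases h) (fun _ h => by cases h)
    · exact h₁ i
    · exact h₂ i
  · rintro rfl
    refine ⟨fun i => rfl, fun i => rfl, fun w a c => ?_⟩
    rcases w with (i | i) | ((i | i) | (i | i))
    · rfl
    · rfl
    · rfl
    · rfl
    · exact absurd rfl (a i)
    · exact absurd rfl (c i)

/-- The circuit for `addRow`. -/
def rowGates (Q N b : ℕ) : List (Gate Q N b (StepWire Q N b)) :=
  (List.finRange (width N)).map fun i =>
    .elementary {wFlag, wCol i} Finset.card_le_two (wRow i) (by simp) notUnitary

/-- The circuit for `addCol`. -/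
def colGates (Q N b : ℕ) : List (Gate Q N b (StepWire Q N b)) :=
  (List.finRange (width N)).map fun i =>
    .elementary {wRow i} (by simp) (wCol i) (by simp) notUnitary

theorem listMatrix_rowGates (Z : Table Q N b) :
    listMatrix Z (rowGates Q N b) = funMatrix addRow := by
  refine (listMatrix_map_not Z (fun i => {wFlag, wCol i}) (fun _ => Finset.card_le_two) wRow
    (by simp) (fun i j h => by simpa using h) _ (List.nodup_finRange _)).trans ?_
  congr 1
  funext y w
  rcases w with (i | i) | ((i | i) | (i | i)) <;> simp [addRow, Bool.decide_and]

theorem listMatrix_colGates (Z : Table Q N b) :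
    listMatrix Z (colGates Q N b) = funMatrix addCol := by
  refine (listMatrix_map_not Z (fun i => {wRow i}) (fun _ => by simp) wCol
    (by simp) (fun i j h => by simpa using h) _ (List.nodup_finRange _)).trans ?_
  congr 1
  funext y w
  rcases w with (i | i) | ((i | i) | (i | i)) <;> simp [addCol]

/-- The axis of the rotations for the real parts. -/
def reAxis : Bool → ℂ := fun _ => -Complex.I

/-- The axis of the rotations for the imaginary parts. -/
def imAxis : Bool → ℂ := fun a => if a then -1 else 1

theorem isAxis_reAxis : IsAxis reAxis := by
  intro c
  simp [reAxis]

theorem isAxis_imAxis : IsAxis imAxis := by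
  intro c
  cases c <;> simp [imAxis]

/-- The contribution of a digit to the number in a word, with unit `u`. -/
noncomputable def digitValue (u : ℝ) {b : ℕ} (i : Fin (b + 1)) : ℝ :=
  if i = Fin.last b then -(u * 2 ^ b) else u * 2 ^ (i : ℕ)

/-- The leading digit of a two's complement word has negative weight, so a word acts as a plain sum
of angles, one for each digit. -/
theorem sum_digitValue (u : ℝ) (z : Fin (b + 1) → Bool) :
    ((List.finRange (b + 1)).map fun i => if z i = true then digitValue u i else 0).sum =
      fixedPoint u z := by
  rw [← Fin.sum_univ_def, Fin.sum_univ_castSucc, fixedPoint, mul_sub, Finset.mul_sum, sub_eq_add_neg]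
  congr 1
  · refine Finset.sum_congr rfl fun i _ => ?_
    simp [digitValue, (Fin.castSucc_lt_last i).ne]
  · simp only [digitValue, if_true]
    split_ifs <;> simp

/-- Rotations of the flag about the axis `p`, controlled by the digits of a word. -/
noncomputable def rotGates {p : Bool → ℂ} (hp : IsAxis p) (u : ℝ)
    (v : Fin (b + 1) → Fin (b + 1) ⊕ Fin (b + 1)) : List (Gate Q N b (StepWire Q N b)) :=
  (List.finRange (b + 1)).map fun i =>
    .elementary {.inr (.inr (v i))} (by simp) wFlag (by simp) (rotUnitary p hp (digitValue u i))

theorem listMatrix_rotGates (Z : Table Q N b) {p : Bool → ℂ} (hp : IsAxis p) (u : ℝ)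
    (v : Fin (b + 1) → Fin (b + 1) ⊕ Fin (b + 1)) :
    listMatrix Z (rotGates hp u v) = rotMatrix flipFlag (fun y => y wFlag) p
      (fun y => fixedPoint u fun i => y (.inr (.inr (v i)))) := by
  refine (listMatrix_map_rot Z hp _ (fun i => (.inr (.inr (v i)) : StepWire Q N b)) wFlag _ _
    _).trans ?_
  simp only [sum_digitValue u fun i => _]
  rfl

/-- Hadamard gates on the displacement and the flag. -/
noncomputable def hadamardGates (Q N b : ℕ) : List (Gate Q N b (StepWire Q N b)) :=
  (Finset.univ : Finset (Fin (width N) ⊕ Unit)).toList.map fun i =>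
    .elementary ∅ (by simp) (.inr (.inl i)) (by simp) hadamardUnitary

/-- The gates of one step. -/
noncomputable def stepGates (Q N b : ℕ) (u : ℝ) : List (Gate Q N b (StepWire Q N b)) :=
  hadamardGates Q N b ++ rowGates Q N b ++ colGates Q N b ++ [.oracle (oraclePlace Q N b)] ++
    rotGates isAxis_reAxis u .inl ++ rotGates isAxis_imAxis u .inr ++
    [.oracle (oraclePlace Q N b)] ++ colGates Q N b ++ rowGates Q N b

/-- The isometry that adjoins the ancillas of a step, displacement and flag in the uniform
superposition and the words in the state zero. -/
noncomputable def uniformIsometry (Q N b : ℕ) :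
    Matrix (StepWire Q N b → Bool) (SysWire Q N → Bool) ℂ :=
  Matrix.of fun x y => if (fun i => x (.inl i)) = y ∧ ∀ w, x (.inr (.inr w)) = false then
    (((√2)⁻¹ : ℝ) : ℂ) ^ (width N + 1) else 0

theorem listMatrix_hadamardGates (Z : Table Q N b) (x : StepWire Q N b → Bool)
    (y : SysWire Q N → Bool) :
    listMatrix Z (hadamardGates Q N b) x (Sum.elim y fun _ => false) = uniformIsometry Q N b x y := by
  refine (listMatrix_map_hadamard Z (fun i => (.inr (.inl i) : StepWire Q N b)) (by simp) (by simp)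
    (fun i j h => by simpa using h) _ (Finset.nodup_toList _) x _ (by simp)).trans ?_
  rw [uniformIsometry, Matrix.of_apply]
  simp [funext_iff]

/-- The word at the address that the registers hold after `addRow` and `addCol`. -/
def shiftedLookup (Z : Table Q N b) (y : StepWire Q N b → Bool) : Word b :=
  Z.lookup (fun i => y (wBlock i)) (fun i => xor (y (wRow i)) (y wFlag && y (wCol i)))
    (fun i => xor (y (wCol i)) (xor (y (wRow i)) (y wFlag && y (wCol i))))

/-- The unitary of a step after the Hadamard gates, if the words are zero. -/
noncomputable def stepMatrix (Z : Table Q N b) (u : ℝ) :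
    Matrix (StepWire Q N b → Bool) (StepWire Q N b → Bool) ℂ :=
  rotMatrix exchange (fun y => y wFlag) imAxis (fun y => fixedPoint u (shiftedLookup Z y).2) *
    rotMatrix exchange (fun y => y wFlag) reAxis (fun y => fixedPoint u (shiftedLookup Z y).1)

/-- The matrix maps into the span of the basis states whose words are zero. -/
def WordsZero {m : Type*} (X : Matrix (StepWire Q N b → Bool) m ℂ) : Prop :=
  ∀ x y, (∃ w, x (.inr (.inr w)) = true) → X x y = 0

theorem WordsZero.diagonal_mul_congr {m : Type*} {X : Matrix (StepWire Q N b → Bool) m ℂ}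
    (hX : WordsZero X) {f g : (StepWire Q N b → Bool) → ℂ}
    (h : ∀ x, (∀ w, x (.inr (.inr w)) = false) → f x = g x) :
    Matrix.diagonal f * X = Matrix.diagonal g * X := by
  ext x y
  rw [Matrix.diagonal_mul, Matrix.diagonal_mul]
  by_cases hx : ∃ w, x (.inr (.inr w)) = true
  · rw [hX x y hx, mul_zero, mul_zero]
  · rw [h x (by simpa using hx)]

theorem WordsZero.diagonal_mul {m : Type*} {X : Matrix (StepWire Q N b → Bool) m ℂ}
    (hX : WordsZero X) (f : (StepWire Q N b → Bool) → ℂ) : WordsZero (Matrix.diagonal f * X) :=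
  fun x y h => by rw [Matrix.diagonal_mul, hX x y h, mul_zero]

theorem WordsZero.exchange_mul {m : Type*} {X : Matrix (StepWire Q N b → Bool) m ℂ}
    (hX : WordsZero X) :
    WordsZero (funMatrix (exchange : (StepWire Q N b → Bool) → StepWire Q N b → Bool) * X) := by
  intro x y h
  rw [Matrix.mul_apply]
  refine Finset.sum_eq_zero fun v _ => ?_
  by_cases hv : x = exchange v
  · subst hv
    rw [hX v y h, mul_zero]
  · simp [funMatrix, hv]

/-- The subspace with zero words is invariant under `exchange`, so angles on other basis states are
irrelevant. They do differ there, since the oracle adds its output to the word that is already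
present. -/
theorem WordsZero.rotMatrix_mul_congr {m : Type*} {X : Matrix (StepWire Q N b → Bool) m ℂ}
    (hX : WordsZero X) {a : (StepWire Q N b → Bool) → Bool} {p : Bool → ℂ}
    {θ θ' : (StepWire Q N b → Bool) → ℝ}
    (h : ∀ x, (∀ w, x (.inr (.inr w)) = false) → θ x = θ' x) :
    rotMatrix exchange a p θ * X = rotMatrix exchange a p θ' * X := by
  simp only [rotMatrix, Matrix.add_mul, Matrix.mul_assoc]
  refine congrArg₂ (· + ·) ?_ ?_
  · exact hX.diagonal_mul_congr fun x hx => by rw [h x hx]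
  · exact hX.exchange_mul.diagonal_mul_congr fun x hx => by rw [h x hx]

theorem WordsZero.rotMatrix_mul {m : Type*} {X : Matrix (StepWire Q N b → Bool) m ℂ}
    (hX : WordsZero X) (a : (StepWire Q N b → Bool) → Bool) (p : Bool → ℂ)
    (θ : (StepWire Q N b → Bool) → ℝ) : WordsZero (rotMatrix (exchange : _ → StepWire Q N b → Bool) a p θ * X) := by
  intro x y h
  simp only [rotMatrix, Matrix.add_mul, Matrix.mul_assoc]
  rw [Matrix.add_apply, hX.diagonal_mul _ x y h, hX.exchange_mul.diagonal_mul _ x y h, add_zero]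

theorem wordsZero_uniformIsometry : WordsZero (uniformIsometry Q N b) := by
  rintro x y ⟨w, hw⟩
  rw [uniformIsometry, Matrix.of_apply, if_neg]
  rintro ⟨-, h⟩
  simp [h w] at hw

theorem listMatrix_stepGates (Z : Table Q N b) (u : ℝ) (x : StepWire Q N b → Bool)
    (y : SysWire Q N → Bool) :
    listMatrix Z (stepGates Q N b u) x (Sum.elim y fun _ => false) =
      (stepMatrix Z u * uniformIsometry Q N b) x y := by
  set B : (StepWire Q N b → Bool) → StepWire Q N b → Bool := oracleMap Z ∘ addCol ∘ addRow with hB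
  set B' : (StepWire Q N b → Bool) → StepWire Q N b → Bool := addRow ∘ addCol ∘ oracleMap Z with hB'
  have h₁ : Function.LeftInverse B' B := fun y => by
    simp only [hB, hB', Function.comp_apply, oracleMap_involutive Z _, addCol_involutive _,
      addRow_involutive _]
  have h₂ : Function.RightInverse B' B := fun y => by
    simp only [hB, hB', Function.comp_apply, oracleMap_involutive Z _, addCol_involutive _,
      addRow_involutive _]
  have hflag : ∀ y, B y wFlag = y wFlag := fun y => rfl
  have hprod : listMatrix Z (stepGates Q N b u) =
      rotMatrix exchange (fun y => y wFlag) imAxis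
        ((fun y => fixedPoint u fun i => y (wIm i)) ∘ B) *
      rotMatrix exchange (fun y => y wFlag) reAxis
        ((fun y => fixedPoint u fun i => y (wRe i)) ∘ B) * listMatrix Z (hadamardGates Q N b) := by
    -- The address and the words stay in place between the two rotations. Inserting `B * B' = 1`
    -- there writes the circuit as a product of two conjugated rotations.
    have hone : funMatrix B * funMatrix B' = 1 := by
      rw [funMatrix_mul, h₂.comp_eq_id, funMatrix_id]
    have e := exchange_eq Z
    rw [← hB, ← hB'] at e
    rw [← e, ← funMatrix_conj_rotMatrix h₁ h₂ hflag, ← funMatrix_conj_rotMatrix h₁ h₂ hflag]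
    simp only [stepGates, listMatrix_append, listMatrix_rowGates, listMatrix_colGates,
      listMatrix_rotGates, listMatrix, toMatrix_oraclePlace, one_mul]
    have hBm : funMatrix B = funMatrix (oracleMap Z) * (funMatrix addCol * funMatrix addRow) := by
      rw [funMatrix_mul, funMatrix_mul]
    have hBm' : funMatrix B' = funMatrix addRow * (funMatrix addCol * funMatrix (oracleMap Z)) := by
      rw [funMatrix_mul, funMatrix_mul]
    calc _ = funMatrix B' * (rotMatrix flipFlag (fun y => y wFlag) imAxis
            (fun y => fixedPoint u fun i => y (wIm i)) *
          (rotMatrix flipFlag (fun y => y wFlag) reAxis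
            (fun y => fixedPoint u fun i => y (wRe i)) *
            (funMatrix B * listMatrix Z (hadamardGates Q N b)))) := by
          rw [hBm, hBm']
          simp only [Matrix.mul_assoc]
      _ = _ := by
          simp only [Matrix.mul_assoc]
          rw [← Matrix.mul_assoc (funMatrix B) (funMatrix B'), hone, one_mul]
  have hcol : ∀ X : Matrix (StepWire Q N b → Bool) (StepWire Q N b → Bool) ℂ,
      (X * listMatrix Z (hadamardGates Q N b)) x (Sum.elim y fun _ => false) =
        (X * uniformIsometry Q N b) x y := by
    intro X
    rw [Matrix.mul_apply, Matrix.mul_apply]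
    simp only [listMatrix_hadamardGates]
  rw [hprod, hcol, stepMatrix, Matrix.mul_assoc, Matrix.mul_assoc]
  -- On zero words the oracle writes exactly the looked-up word, so the digits give the intended
  -- angle.
  have hre : ∀ y : StepWire Q N b → Bool, (∀ w, y (.inr (.inr w)) = false) →
      ((fun y => fixedPoint u fun i => y (wRe i)) ∘ B) y = fixedPoint u (shiftedLookup Z y).1 := by
    intro y hy
    simp [hB, oracleMap, shiftedLookup, addRow, addCol, hy]
  have him : ∀ y : StepWire Q N b → Bool, (∀ w, y (.inr (.inr w)) = false) →
      ((fun y => fixedPoint u fun i => y (wIm i)) ∘ B) y = fixedPoint u (shiftedLookup Z y).2 := by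
    intro y hy
    simp [hB, oracleMap, shiftedLookup, addRow, addCol, hy]
  rw [wordsZero_uniformIsometry.rotMatrix_mul_congr hre,
    (wordsZero_uniformIsometry.rotMatrix_mul _ _ _).rotMatrix_mul_congr him]

/-- One step, as a circuit. -/
noncomputable def stepCircuit (Q N b : ℕ) (u : ℝ) : Circuit Q N b where
  ancillas := Fintype.card (StepAnc N b)
  gates := (stepGates Q N b u).map (Gate.map
    ((Function.Embedding.refl _).sumMap (Fintype.equivFin (StepAnc N b)).toEmbedding))

/-- There are `w + 1 + 2 * (b + 1)` ancillas, `w + 1` Hadamard gates, `4 * w` gates for the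
addresses, `2 * (b + 1)` rotations and two oracle calls, where `w = width N`. -/
theorem time_stepCircuit (u : ℝ) (τ : ℕ) :
    (stepCircuit Q N b u).time τ = 6 * width N + 4 * (b + 1) + 2 + 2 * τ := by
  have h : (Gate.time τ : Gate Q N b (SysWire Q N ⊕ Fin (Fintype.card (StepAnc N b))) → ℕ) ∘
      Gate.map ((Function.Embedding.refl _).sumMap
        (Fintype.equivFin (StepAnc N b)).toEmbedding) = Gate.time τ :=
    funext fun g => Gate.time_map τ _ g
  have e : (stepCircuit Q N b u).time τ =
      Fintype.card (StepAnc N b) + ((stepGates Q N b u).map (Gate.time τ)).sum := by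
    simp only [stepCircuit, Circuit.time, List.map_map]
    rw [h]
  rw [e]
  simp [stepGates, hadamardGates, rowGates, colGates, rotGates, Function.comp_def, Gate.time]
  ring

theorem dualChannel_map_equiv (Z : Table Q N b) {S A A' : Type} [Fintype S] [DecidableEq S]
    [Fintype A] [DecidableEq A] [Fintype A'] [DecidableEq A'] (e : A ≃ A')
    (l : List (Gate Q N b (S ⊕ A))) {r : ℕ}
    (O : Matrix (Fin r × (S → Bool)) (Fin r × (S → Bool)) ℂ) :
    dualChannel (listMatrix Z
      (l.map (Gate.map ((Function.Embedding.refl S).sumMap e.toEmbedding)))) O =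
      dualChannel (listMatrix Z l) O := by
  have hk : ∀ z : A' → Bool,
      krausOp (listMatrix Z
        (l.map (Gate.map ((Function.Embedding.refl S).sumMap e.toEmbedding)))) z =
      krausOp (listMatrix Z l) (z ∘ e) := by
    intro z
    ext x y
    simp only [krausOp, Matrix.of_apply]
    rw [listMatrix_map, if_pos]
    · congr 1 <;> funext w <;> rcases w with w | w <;> simp
    · rintro (w | w) hw
      · exact absurd ⟨.inl w, rfl⟩ hw
      · exact absurd ⟨.inr (e.symm w), by simp⟩ hw
  simp only [dualChannel, hk]
  exact (e.symm.arrowCongr (Equiv.refl Bool)).sum_comp fun z : A → Bool =>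
    ((1 : Matrix (Fin r) (Fin r) ℂ) ⊗ₖ krausOp (listMatrix Z l) z)ᴴ * O *
    ((1 : Matrix (Fin r) (Fin r) ℂ) ⊗ₖ krausOp (listMatrix Z l) z)

theorem dualChannel_stepCircuit (Z : Table Q N b) (u : ℝ) {r : ℕ}
    (O : Matrix (Fin r × (SysWire Q N → Bool)) (Fin r × (SysWire Q N → Bool)) ℂ) :
    dualChannel (listMatrix Z (stepCircuit Q N b u).gates) O =
      dualChannel (listMatrix Z (stepGates Q N b u)) O :=
  dualChannel_map_equiv Z (Fintype.equivFin (StepAnc N b)) (stepGates Q N b u) O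

end Step

/-! ### The one-sparse generator, its norm and its compression. -/

section Generator

variable {Q N b : ℕ}

/-- A function of addresses: number of the matrix, row, column. -/
abbrev AddressFun (Q N : ℕ) : Type :=
  (Fin (width Q) → Bool) → (Fin (width N) → Bool) → (Fin (width N) → Bool) → ℂ

/-- The value at the address that the registers hold after `addRow` and `addCol`. -/
def shiftedValue (f : AddressFun Q N) (y : StepWire Q N b → Bool) : ℂ :=
  f (fun i => y (wBlock i)) (fun i => xor (y (wRow i)) (y wFlag && y (wCol i)))
    (fun i => xor (y (wCol i)) (xor (y (wRow i)) (y wFlag && y (wCol i))))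

/-- The generator of a step, to first order. -/
noncomputable def generator (b : ℕ) (f : AddressFun Q N) :
    Matrix (StepWire Q N b → Bool) (StepWire Q N b → Bool) ℂ :=
  Matrix.diagonal (fun y => if y wFlag then star (shiftedValue f y) else shiftedValue f y) *
    funMatrix exchange

theorem generator_sub (f g : AddressFun Q N) :
    generator b f - generator b g = generator b (f - g) := by
  rw [generator, generator, generator, ← Matrix.sub_mul, Matrix.diagonal_sub]
  congr 2
  funext y
  simp only [shiftedValue, Pi.sub_apply, star_sub]
  split_ifs <;> rfl

section Norm

open scoped Matrix.Norms.L2Operator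

theorem norm_diagonal_le {Ω : Type*} [Fintype Ω] [DecidableEq Ω] {g : Ω → ℂ} {m : ℝ} (hm : 0 ≤ m)
    (h : ∀ y, ‖g y‖ ≤ m) : ‖Matrix.diagonal g‖ ≤ m := by
  rw [Matrix.l2_opNorm_diagonal]
  exact (pi_norm_le_iff_of_nonneg hm).2 h

theorem norm_diagonal_mul_funMatrix_le {Ω : Type*} [Fintype Ω] [DecidableEq Ω] {g : Ω → ℂ} {m : ℝ}
    (hm : 0 ≤ m) (h : ∀ y, ‖g y‖ ≤ m) {F : Ω → Ω} (hF : Function.Injective F) :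
    ‖Matrix.diagonal g * funMatrix F‖ ≤ m := by
  refine (Matrix.l2_opNorm_mul _ _).trans ?_
  exact (mul_le_mul (norm_diagonal_le hm h) (norm_funMatrix_le hF) (norm_nonneg _) hm).trans
    (mul_one m).le

theorem norm_generator_le {f : AddressFun Q N} {m : ℝ} (hm : 0 ≤ m) (h : ∀ q i j, ‖f q i j‖ ≤ m) :
    ‖generator b f‖ ≤ m := by
  refine norm_diagonal_mul_funMatrix_le hm (fun y => ?_) exchange_involutive.injective
  split_ifs
  · rw [norm_star]
    exact h _ _ _
  · exact h _ _ _

/-- A rotation by a small angle, to first order. -/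
theorem norm_rotMatrix_sub_le {Ω : Type*} [Fintype Ω] [DecidableEq Ω] {F : Ω → Ω}
    (hF : Function.Injective F) {a : Ω → Bool} {p : Bool → ℂ} (hp : ∀ c, ‖p c‖ ≤ 1) {θ : Ω → ℝ}
    {m : ℝ} (hm : 0 ≤ m) (hm1 : m ≤ 1) (h : ∀ y, |θ y| ≤ m) :
    ‖rotMatrix F a p θ - 1 - Matrix.diagonal (fun y => p (a y) * (θ y : ℂ)) * funMatrix F‖ ≤
      m ^ 2 := by
  have e : rotMatrix F a p θ - 1 - Matrix.diagonal (fun y => p (a y) * (θ y : ℂ)) * funMatrix F =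
      Matrix.diagonal (fun y => ((Real.cos (θ y) - 1 : ℝ) : ℂ)) +
        Matrix.diagonal (fun y => p (a y) * ((Real.sin (θ y) - θ y : ℝ) : ℂ)) * funMatrix F := by
    rw [rotMatrix, ← Matrix.diagonal_one, add_sub_right_comm, Matrix.diagonal_sub, add_sub_assoc,
      ← Matrix.sub_mul, Matrix.diagonal_sub]
    congr 3
    · funext y
      push_cast
      rfl
    · funext y
      push_cast
      ring
  rw [e]
  refine (norm_add_le _ _).trans ?_
  have hθ : ∀ y, θ y ^ 2 ≤ m ^ 2 := fun y => by
    rw [← sq_abs]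
    exact pow_le_pow_left₀ (abs_nonneg _) (h y) 2
  have h1 : ‖Matrix.diagonal (fun y => ((Real.cos (θ y) - 1 : ℝ) : ℂ))‖ ≤ m ^ 2 / 2 := by
    refine norm_diagonal_le (by positivity) fun y => ?_
    rw [Complex.norm_real, Real.norm_eq_abs, abs_sub_comm, abs_of_nonneg (by
      linarith [Real.cos_le_one (θ y)])]
    linarith [Real.one_sub_sq_div_two_le_cos (x := θ y), hθ y]
  have h2 : ‖Matrix.diagonal (fun y => p (a y) * ((Real.sin (θ y) - θ y : ℝ) : ℂ)) * funMatrix F‖ ≤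
      m ^ 2 / 2 := by
    refine norm_diagonal_mul_funMatrix_le (by positivity) (fun y => ?_) hF
    rw [norm_mul, Complex.norm_real, Real.norm_eq_abs]
    have hb : |Real.sin (θ y) - θ y| ≤ m ^ 2 / 2 := by
      have h3 := Real.sin_bound ((h y).trans hm1)
      have h4 : |θ y| ^ 3 ≤ m ^ 2 := by
        calc |θ y| ^ 3 ≤ m ^ 3 := pow_le_pow_left₀ (abs_nonneg _) (h y) 3
          _ ≤ m ^ 2 := pow_le_pow_of_le_one hm hm1 (by norm_num)
      have h5 : |θ y| ^ 5 ≤ m ^ 2 := by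
        calc |θ y| ^ 5 ≤ m ^ 5 := pow_le_pow_left₀ (abs_nonneg _) (h y) 5
          _ ≤ m ^ 2 := pow_le_pow_of_le_one hm hm1 (by norm_num)
      have h6 : |θ y ^ 3 / 6| ≤ m ^ 2 / 6 := by
        rw [abs_div, abs_pow, abs_of_pos (by norm_num : (0 : ℝ) < 6)]
        linarith
      have h7 : Real.sin (θ y) - θ y = (Real.sin (θ y) - (θ y - θ y ^ 3 / 6)) - θ y ^ 3 / 6 := by
        ring
      rw [h7]
      refine (abs_sub _ _).trans ?_
      nlinarith [sq_nonneg m]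
    calc ‖p (a y)‖ * |Real.sin (θ y) - θ y| ≤ 1 * (m ^ 2 / 2) :=
          mul_le_mul (hp _) hb (abs_nonneg _) zero_le_one
      _ = m ^ 2 / 2 := one_mul _
  linarith

/-- The two remainders and the product `α * β` contribute `m ^ 2` each; the other three terms are of
order three or four, hence at most `m ^ 2` each since `m ≤ 1`. -/
theorem norm_mul_sub_sub_le {R : Type*} [NormedRing R] {x y α β : R} {m : ℝ} (hm : 0 ≤ m)
    (hm1 : m ≤ 1) (hx : ‖x - 1 - α‖ ≤ m ^ 2) (hy : ‖y - 1 - β‖ ≤ m ^ 2) (hα : ‖α‖ ≤ m)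
    (hβ : ‖β‖ ≤ m) : ‖x * y - 1 - (α + β)‖ ≤ 6 * m ^ 2 := by
  set ρ := x - 1 - α with hρ
  set σ := y - 1 - β with hσ
  have e : x * y - 1 - (α + β) = ρ + σ + α * β + (α * σ + ρ * β + ρ * σ) := by
    have h1 : x = 1 + α + ρ := by rw [hρ]; abel
    have h2 : y = 1 + β + σ := by rw [hσ]; abel
    rw [h1, h2]
    noncomm_ring
  have hmul : ∀ {a c : R} {s t : ℝ}, ‖a‖ ≤ s → ‖c‖ ≤ t → ‖a * c‖ ≤ s * t := fun ha hc =>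
    (norm_mul_le _ _).trans (mul_le_mul ha hc (norm_nonneg _) ((norm_nonneg _).trans ha))
  have hm2 : m ^ 2 ≤ 1 := pow_le_one₀ hm hm1
  rw [e]
  refine (norm_add_le _ _).trans ?_
  have a1 := (norm_add_le (ρ + σ) (α * β)).trans (add_le_add_left (norm_add_le _ _) _)
  have a2 := (norm_add_le (α * σ + ρ * β) (ρ * σ)).trans (add_le_add_left (norm_add_le _ _) _)
  have b1 := hmul hα hβ
  have b2 := hmul hα hy
  have b3 := hmul hx hβ
  have b4 := hmul hx hy
  nlinarith [sq_nonneg m]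

/-- The unitary of a step, to first order. -/
theorem norm_stepMatrix_sub_le (Z : Table Q N b) (u : ℝ) {m : ℝ} (hm : 0 ≤ m) (hm1 : m ≤ 1)
    (h : ∀ q i j, ‖(Z.lookup q i j).value u‖ ≤ m) :
    ‖stepMatrix Z u - 1 - (-Complex.I) • generator b fun q i j => (Z.lookup q i j).value u‖ ≤
      6 * m ^ 2 := by
  have hre : ∀ y : StepWire Q N b → Bool, |fixedPoint u (shiftedLookup Z y).1| ≤ m := fun y =>
    (Complex.abs_re_le_norm (Word.value u (shiftedLookup Z y))).trans (h _ _ _)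
  have him : ∀ y : StepWire Q N b → Bool, |fixedPoint u (shiftedLookup Z y).2| ≤ m := fun y =>
    (Complex.abs_im_le_norm (Word.value u (shiftedLookup Z y))).trans (h _ _ _)
  have hpre : ∀ c, ‖reAxis c‖ ≤ 1 := fun c => by simp [reAxis]
  have hpim : ∀ c, ‖imAxis c‖ ≤ 1 := fun c => by cases c <;> simp [imAxis]
  have hexch := (exchange_involutive (Q := Q) (N := N) (b := b)).injective
  -- The two axes are chosen so that the real and the imaginary rotation together give `-i` times
  -- the block with off-diagonal entries `z` and `star z`.
  have e : (-Complex.I) • generator b (fun q i j => (Z.lookup q i j).value u) =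
      Matrix.diagonal (fun y : StepWire Q N b → Bool =>
        imAxis (y wFlag) * (fixedPoint u (shiftedLookup Z y).2 : ℂ)) * funMatrix exchange +
      Matrix.diagonal (fun y : StepWire Q N b → Bool =>
        reAxis (y wFlag) * (fixedPoint u (shiftedLookup Z y).1 : ℂ)) * funMatrix exchange := by
    rw [generator, ← Matrix.add_mul, Matrix.diagonal_add, ← Matrix.smul_mul, ← Matrix.diagonal_smul]
    congr 2
    funext y
    have hv : shiftedValue (fun q i j => (Z.lookup q i j).value u) y =
        (fixedPoint u (shiftedLookup Z y).1 : ℂ) +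
          (fixedPoint u (shiftedLookup Z y).2 : ℂ) * Complex.I := by
      apply Complex.ext <;> simp [shiftedValue, shiftedLookup, Word.value]
    simp only [Pi.smul_apply, hv, smul_eq_mul]
    cases y wFlag
    · simp only [Bool.false_eq_true, if_false, imAxis, reAxis]
      linear_combination (-(fixedPoint u (shiftedLookup Z y).2 : ℂ)) * Complex.I_mul_I
    · simp only [if_true, imAxis, reAxis, RCLike.star_def, map_add, map_mul, Complex.conj_ofReal,
        Complex.conj_I]
      linear_combination (fixedPoint u (shiftedLookup Z y).2 : ℂ) * Complex.I_mul_I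
  rw [e, stepMatrix]
  refine norm_mul_sub_sub_le hm hm1 (norm_rotMatrix_sub_le hexch hpim hm hm1 him)
    (norm_rotMatrix_sub_le hexch hpre hm hm1 hre) ?_ ?_
  · refine norm_diagonal_mul_funMatrix_le hm (fun y => ?_) hexch
    rw [norm_mul, Complex.norm_real, Real.norm_eq_abs]
    exact (mul_le_mul (hpim _) (him y) (abs_nonneg _) zero_le_one).trans (one_mul m).le
  · refine norm_diagonal_mul_funMatrix_le hm (fun y => ?_) hexch
    rw [norm_mul, Complex.norm_real, Real.norm_eq_abs]
    exact (mul_le_mul (hpre _) (hre y) (abs_nonneg _) zero_le_one).trans (one_mul m).le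

end Norm

/-- The basis state with given values of system, displacement and flag, and zero words. -/
def stepState (b : ℕ) (y : SysWire Q N → Bool) (d : Fin (width N) → Bool) (c : Bool) :
    StepWire Q N b → Bool :=
  Sum.elim y (Sum.elim (Sum.elim d fun _ => c) fun _ => false)

theorem sum_stepState (g : (StepWire Q N b → Bool) → ℂ)
    (hg : ∀ x, (∃ w, x (.inr (.inr w)) = true) → g x = 0) :
    ∑ x, g x = ∑ y, ∑ d, ∑ c, g (stepState b y d c) := by
  have h : ∑ p : (SysWire Q N → Bool) × (Fin (width N) → Bool) × Bool,
      g (stepState b p.1 p.2.1 p.2.2) = ∑ x, g x := by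
    refine Fintype.sum_of_injective (fun p => stepState b p.1 p.2.1 p.2.2) ?_ _ _ ?_ fun _ => rfl
    · rintro ⟨y, d, c⟩ ⟨y', d', c'⟩ e
      have e1 : y = y' := funext fun i => congrFun e (.inl i)
      have e2 : d = d' := funext fun i => congrFun e (wCol i)
      have e3 : c = c' := congrFun e wFlag
      rw [e1, e2, e3]
    · intro x hx
      apply hg
      by_contra hw
      refine hx ⟨(fun i => x (.inl i), fun i => x (wCol i), x wFlag), ?_⟩
      funext w
      rcases w with w | ((w | w) | w)
      · rfl
      · rfl
      · rfl
      · have : x (.inr (.inr w)) = false := by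
          by_contra h'
          exact hw ⟨w, by simpa using h'⟩
        exact this.symm
  rw [← h, Fintype.sum_prod_type]
  simp only [Fintype.sum_prod_type]

theorem uniformIsometry_stepState (y : SysWire Q N → Bool) (d : Fin (width N) → Bool) (c : Bool)
    (x : SysWire Q N → Bool) :
    uniformIsometry Q N b (stepState b y d c) x =
      if y = x then (((√2)⁻¹ : ℝ) : ℂ) ^ (width N + 1) else 0 := by
  simp [uniformIsometry, stepState]

theorem inv_sqrt_two_pow_mul_self (n : ℕ) :
    (((√2)⁻¹ : ℝ) : ℂ) ^ n * (((√2)⁻¹ : ℝ) : ℂ) ^ n = ((2 : ℂ) ^ n)⁻¹ := by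
  rw [← mul_pow, ← Complex.ofReal_mul, ← mul_inv, Real.mul_self_sqrt (by norm_num), ← inv_pow]
  norm_num

theorem uniformIsometry_conjTranspose_mul_self :
    (uniformIsometry Q N b)ᴴ * uniformIsometry Q N b = 1 := by
  ext x x'
  rw [Matrix.mul_apply, sum_stepState]
  · simp only [Matrix.conjTranspose_apply, uniformIsometry_stepState]
    have h : ∀ y : SysWire Q N → Bool,
        star (if y = x then (((√2)⁻¹ : ℝ) : ℂ) ^ (width N + 1) else 0) *
        (if y = x' then (((√2)⁻¹ : ℝ) : ℂ) ^ (width N + 1) else 0) =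
        if y = x then if x = x' then ((2 : ℂ) ^ (width N + 1))⁻¹ else 0 else 0 := by
      intro y
      by_cases h1 : y = x
      · subst h1
        by_cases h2 : y = x'
        · simp only [h2, if_true, RCLike.star_def, map_pow, Complex.conj_ofReal]
          exact inv_sqrt_two_pow_mul_self _
        · simp [h2]
      · simp [h1]
    simp only [h, Finset.sum_const, Finset.card_univ, Fintype.card_bool, Fintype.card_fun,
      Fintype.card_fin, Finset.sum_ite_eq', Finset.mem_univ, if_true, ← Finset.smul_sum,
      Matrix.one_apply]
    split_ifs
    · simp only [nsmul_eq_mul]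
      push_cast
      field_simp
      ring
    · simp
  · intro v hv
    rw [wordsZero_uniformIsometry v x' hv, mul_zero]

/-- The compression of the generator to the uniform superposition. -/
theorem uniformIsometry_generator {f : AddressFun Q N} (hf : ∀ q i j, star (f q i j) = f q j i)
    (x x' : SysWire Q N → Bool) :
    ((uniformIsometry Q N b)ᴴ * generator b f * uniformIsometry Q N b) x x' =
      if (fun i => x (.inl i)) = (fun i => x' (.inl i)) then
        ((2 : ℂ) ^ width N)⁻¹ * f (fun i => x (.inl i)) (fun i => x (.inr i)) (fun i => x' (.inr i))
      else 0 := by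
  rw [Matrix.mul_apply, sum_stepState]
  · have h1 : ∀ v : StepWire Q N b → Bool, ((uniformIsometry Q N b)ᴴ * generator b f) x v =
        star (uniformIsometry Q N b (exchange v) x) *
          (if exchange v wFlag then star (shiftedValue f (exchange v))
            else shiftedValue f (exchange v)) := by
      intro v
      rw [generator, ← Matrix.mul_assoc, Matrix.mul_apply, Finset.sum_eq_single (exchange v)]
      · rw [Matrix.mul_diagonal, Matrix.conjTranspose_apply]
        simp [funMatrix]
      · intro w _ hw
        simp [funMatrix, hw]
      · simp
    have h2 : ∀ (y : SysWire Q N → Bool) d c, exchange (stepState b y d c) =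
        stepState b (Sum.elim (fun i => y (.inl i)) fun i => xor (y (.inr i)) (d i)) d (!c) := by
      intro y d c
      funext w
      rcases w with (w | w) | ((w | w) | w) <;> rfl
    -- Hermiticity of `f` makes the amplitude independent of the flag; the conjugate for a set flag
    -- compensates for the exchanged row and column.
    have h3 : ∀ (y : SysWire Q N → Bool) d c, (if exchange (stepState b y d c) wFlag then
        star (shiftedValue f (exchange (stepState b y d c)))
          else shiftedValue f (exchange (stepState b y d c))) =
        f (fun i => y (.inl i)) (fun i => xor (y (.inr i)) (d i)) (fun i => y (.inr i)) := by
      intro y d c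
      rw [h2]
      cases c
      · simp only [stepState, Sum.elim_inr, Sum.elim_inl, shiftedValue, hf, Bool.not_false, if_true,
          Bool.true_and]
        congr 1 <;> funext i <;> cases y (.inr i) <;> cases d i <;> rfl
      · simp only [stepState, Sum.elim_inr, Sum.elim_inl, shiftedValue, Bool.not_true,
          Bool.false_eq_true, if_false, Bool.false_and, Bool.xor_false]
        congr 1
        funext i
        cases y (.inr i) <;> cases d i <;> rfl
    have h1' : ∀ (y : SysWire Q N → Bool) d c,
        ((uniformIsometry Q N b)ᴴ * generator b f) x (stepState b y d c) =
        star (if Sum.elim (fun i => y (.inl i)) (fun i => xor (y (.inr i)) (d i)) = x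
          then (((√2)⁻¹ : ℝ) : ℂ) ^ (width N + 1) else 0) *
          f (fun i => y (.inl i)) (fun i => xor (y (.inr i)) (d i)) (fun i => y (.inr i)) := by
      intro y d c
      rw [h1, h3, h2, uniformIsometry_stepState]
    simp only [h1', uniformIsometry_stepState]
    -- For given rows exactly one displacement contributes, their bitwise sum. The weight is the
    -- squared amplitude `2 ^ (-(width N + 1))`, doubled by the two values of the flag.
    have h4 : ∀ (y : SysWire Q N → Bool) (d : Fin (width N) → Bool),
        (Sum.elim (fun i => y (.inl i)) (fun i => xor (y (.inr i)) (d i)) = x) ↔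
        d = (fun i => xor (x (.inr i)) (y (.inr i))) ∧
          (fun i => x (.inl i)) = (fun i => y (.inl i)) := by
      intro y d
      constructor
      · rintro rfl
        refine ⟨?_, rfl⟩
        funext i
        change d i = xor (xor (y (.inr i)) (d i)) (y (.inr i))
        cases y (.inr i) <;> cases d i <;> rfl
      · rintro ⟨rfl, h⟩
        funext w
        rcases w with w | w
        · exact (congrFun h w).symm
        · simp only [Sum.elim_inr]
          cases y (.inr w) <;> cases x (.inr w) <;> rfl
    have h5 : ∀ (y : SysWire Q N → Bool) (d : Fin (width N) → Bool),
        ∑ _c : Bool, star (if Sum.elim (fun i => y (.inl i)) (fun i => xor (y (.inr i)) (d i)) = x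
          then (((√2)⁻¹ : ℝ) : ℂ) ^ (width N + 1) else 0) *
          f (fun i => y (.inl i)) (fun i => xor (y (.inr i)) (d i)) (fun i => y (.inr i)) *
          (if y = x' then (((√2)⁻¹ : ℝ) : ℂ) ^ (width N + 1) else 0) =
        if y = x' then if d = (fun i => xor (x (.inr i)) (y (.inr i))) then
          (if (fun i => x (.inl i)) = (fun i => x' (.inl i)) then
            ((2 : ℂ) ^ width N)⁻¹ *
              f (fun i => x (.inl i)) (fun i => x (.inr i)) (fun i => x' (.inr i)) else 0)
          else 0 else 0 := by
      intro y d
      by_cases hy : y = x'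
      · subst hy
        simp only [h4, ite_and, if_true]
        by_cases hd : d = (fun i => xor (x (.inr i)) (y (.inr i)))
        · by_cases hq : (fun i => x (.inl i)) = (fun i => y (.inl i))
          · simp only [hd, hq, if_true, Finset.sum_const, Finset.card_univ, Fintype.card_bool,
              RCLike.star_def, map_pow, Complex.conj_ofReal]
            have e : (fun i => xor (y (.inr i)) (xor (x (.inr i)) (y (.inr i)))) =
                fun i => x (.inr i) := by
              funext i
              cases y (.inr i) <;> cases x (.inr i) <;> rfl
            rw [e]
            have h6 := inv_sqrt_two_pow_mul_self (width N + 1)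
            rw [pow_succ (2 : ℂ), mul_inv] at h6
            rw [nsmul_eq_mul]
            push_cast
            push_cast at h6
            linear_combination (2 * f (fun i => y (.inl i)) (fun i => x (.inr i))
              (fun i => y (.inr i))) * h6
          · simp [hd, hq]
        · simp [hd]
      · simp [hy]
    simp only [h5]
    rw [Finset.sum_eq_single x']
    · simp
    · intro y _ hy
      simp [hy]
    · simp
  · intro v hv
    rw [wordsZero_uniformIsometry v x' hv, mul_zero]

end Generator

/-! ### The matrix exponential: remainder estimate and intertwining. -/

section Exponential

open scoped Nat

/-- The power series from the quadratic term on is dominated by that of the real exponential at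
`‖x‖`. -/
theorem norm_exp_sub_one_sub_le {𝔸 : Type*} [NormedRing 𝔸] [NormedAlgebra ℂ 𝔸] [CompleteSpace 𝔸]
    {x : 𝔸} (hx : ‖x‖ ≤ 1) : ‖NormedSpace.exp x - 1 - x‖ ≤ ‖x‖ ^ 2 := by
  have h1 := (hasSum_nat_add_iff' 2).2 (NormedSpace.exp_series_hasSum_exp' (𝕂 := ℂ) x)
  have h2 := (hasSum_nat_add_iff' 2).2 (NormedSpace.exp_series_hasSum_exp' (𝕂 := ℝ) ‖x‖)
  have h3 := h1.norm_le_of_bounded h2 fun n => by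
    rw [norm_smul, smul_eq_mul, norm_inv, Complex.norm_natCast]
    exact mul_le_mul_of_nonneg_left (norm_pow_le' x (by omega)) (by positivity)
  simp only [Finset.sum_range_succ, Finset.sum_range_zero, Nat.factorial_zero, Nat.factorial_one,
    Nat.cast_one, inv_one, one_smul, pow_zero, pow_one, zero_add, ← Real.exp_eq_exp_ℝ] at h3
  rw [← sub_sub, ← sub_sub] at h3
  refine h3.trans ?_
  have h4 := Real.abs_exp_sub_one_sub_id_le (x := ‖x‖) (by rwa [abs_norm])
  exact (le_abs_self _).trans h4

open scoped Matrix.Norms.L2Operator in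
theorem exp_mul_of_mul_eq {m n : Type*} [Fintype m] [Fintype n] [DecidableEq m] [DecidableEq n]
    {X : Matrix m m ℂ} {Y : Matrix n n ℂ} {J : Matrix m n ℂ} (h : X * J = J * Y) :
    NormedSpace.exp X * J = J * NormedSpace.exp Y := by
  have h1 := (NormedSpace.exp_series_hasSum_exp' (𝕂 := ℂ) X).map
    (AddMonoidHom.mk' (fun A : Matrix m m ℂ => A * J) fun a b => Matrix.add_mul a b J)
    (continuous_id.matrix_mul continuous_const)
  have h2 := (NormedSpace.exp_series_hasSum_exp' (𝕂 := ℂ) Y).map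
    (AddMonoidHom.mk' (fun A : Matrix n n ℂ => J * A) fun a b => Matrix.mul_add J a b)
    (continuous_const.matrix_mul continuous_id)
  have h3 : ∀ k : ℕ, X ^ k * J = J * Y ^ k := by
    intro k
    induction k with
    | zero => simp
    | succ k ih =>
      rw [pow_succ, pow_succ', Matrix.mul_assoc, h, ← Matrix.mul_assoc, ih, Matrix.mul_assoc,
        pow_mul_comm']
  refine h1.unique ?_
  convert! h2 using 1
  funext k
  simp [h3]

end Exponential

/-! ### Observables that act trivially on the ancillas. -/

section LiftedObservable

open scoped Matrix.Norms.L2Operator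

variable {r : ℕ} {S A : Type}

/-- Separate the values of the ancilla qubits from the rest. -/
def ancillaEquiv (r : ℕ) (S A : Type) :
    Fin r × (S ⊕ A → Bool) ≃ (A → Bool) × (Fin r × (S → Bool)) where
  toFun p := (fun a => p.2 (.inr a), p.1, fun s => p.2 (.inl s))
  invFun q := (q.2.1, Sum.elim q.2.2 q.1)
  left_inv p := by
    refine Prod.ext rfl (funext fun w => ?_)
    rcases w with w | w <;> rfl
  right_inv q := rfl

theorem ancillaEquiv_symm_apply (z : A → Bool) (p : Fin r × (S → Bool)) :
    (ancillaEquiv r S A).symm (z, p) = (p.1, Sum.elim p.2 z) := rfl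

/-- The observable `O ⊗ 1`, with the identity on the ancilla qubits. -/
noncomputable def liftObservable (A : Type) [Fintype A] [DecidableEq A]
    (O : Matrix (Fin r × (S → Bool)) (Fin r × (S → Bool)) ℂ) :
    Matrix (Fin r × (S ⊕ A → Bool)) (Fin r × (S ⊕ A → Bool)) ℂ :=
  Matrix.of fun x y => if (ancillaEquiv r S A x).1 = (ancillaEquiv r S A y).1 then
    O (ancillaEquiv r S A x).2 (ancillaEquiv r S A y).2 else 0

variable [Fintype A] [DecidableEq A]

theorem conjTranspose_liftObservable (O : Matrix (Fin r × (S → Bool)) (Fin r × (S → Bool)) ℂ) :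
    (liftObservable A O)ᴴ = liftObservable A Oᴴ := by
  ext x y
  simp only [liftObservable, Matrix.conjTranspose_apply, Matrix.of_apply]
  by_cases h : (ancillaEquiv r S A x).1 = (ancillaEquiv r S A y).1
  · simp [h]
  · simp [h, Ne.symm h]

variable [Fintype S] [DecidableEq S]

theorem norm_liftObservable_le (O : Matrix (Fin r × (S → Bool)) (Fin r × (S → Bool)) ℂ) :
    ‖liftObservable A O‖ ≤ ‖O‖ :=
  norm_direct_sum_le (ancillaEquiv r S A) (ancillaEquiv r S A) O

/-- Summing over the final ancilla states traces them out, which in the Heisenberg picture means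
inserting the identity on the ancillas (Stinespring form). -/
theorem dualChannel_eq_conj (L : Matrix (S ⊕ A → Bool) (S ⊕ A → Bool) ℂ)
    (V : Matrix (S ⊕ A → Bool) (S → Bool) ℂ) (hV : ∀ x y, L x (Sum.elim y fun _ => false) = V x y)
    (O : Matrix (Fin r × (S → Bool)) (Fin r × (S → Bool)) ℂ) :
    dualChannel L O = ((1 : Matrix (Fin r) (Fin r) ℂ) ⊗ₖ V)ᴴ * liftObservable A O *
      ((1 : Matrix (Fin r) (Fin r) ℂ) ⊗ₖ V) := by
  set K := (1 : Matrix (Fin r) (Fin r) ℂ) ⊗ₖ V with hK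
  have hk : ∀ z : A → Bool, (1 : Matrix (Fin r) (Fin r) ℂ) ⊗ₖ krausOp L z =
      Matrix.of fun p p' => K ((ancillaEquiv r S A).symm (z, p)) p' := by
    intro z
    ext p p'
    simp [hK, krausOp, Matrix.kroneckerMap_apply, ancillaEquiv_symm_apply, hV]
  ext p p'
  simp only [dualChannel, hk, Matrix.sum_apply]
  rw [Matrix.mul_apply, ← (ancillaEquiv r S A).symm.sum_comp, Fintype.sum_prod_type]
  refine Finset.sum_congr rfl fun z _ => ?_
  rw [Matrix.mul_apply]
  refine Finset.sum_congr rfl fun v _ => ?_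
  simp only [Matrix.of_apply]
  congr 1
  rw [Matrix.mul_apply, Matrix.mul_apply]
  conv_rhs => rw [← (ancillaEquiv r S A).symm.sum_comp, Fintype.sum_prod_type]
  rw [Finset.sum_eq_single z]
  · simp [liftObservable, Matrix.conjTranspose_apply]
  · intro z' _ hz
    simp [liftObservable, hz]
  · simp

variable {α : (A → Bool) → ℂ} {V : Matrix (S ⊕ A → Bool) (S → Bool) ℂ}

/-- An isometry that adjoins a fixed ancilla state commutes with observables of the other factors.
This is what reduces the first-order terms to a compression. -/
theorem liftObservable_mul
    (hV : ∀ x y, V x y = if (fun i => x (.inl i)) = y then α fun i => x (.inr i) else 0)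
    (O : Matrix (Fin r × (S → Bool)) (Fin r × (S → Bool)) ℂ) :
    liftObservable A O * ((1 : Matrix (Fin r) (Fin r) ℂ) ⊗ₖ V) =
      ((1 : Matrix (Fin r) (Fin r) ℂ) ⊗ₖ V) * O := by
  have hk : ∀ z p p', ((1 : Matrix (Fin r) (Fin r) ℂ) ⊗ₖ V) ((ancillaEquiv r S A).symm (z, p)) p' =
      if p = p' then α z else 0 := by
    rintro z ⟨i, x⟩ ⟨j, y⟩
    simp only [ancillaEquiv_symm_apply, Matrix.kroneckerMap_apply, hV, Matrix.one_apply,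
      Sum.elim_inl, Sum.elim_inr, Prod.mk.injEq]
    by_cases h1 : i = j <;> by_cases h2 : x = y <;> simp [h1, h2]
  ext x p'
  obtain ⟨⟨z, p⟩, rfl⟩ := (ancillaEquiv r S A).symm.surjective x
  rw [Matrix.mul_apply, Matrix.mul_apply, ← (ancillaEquiv r S A).symm.sum_comp,
    Fintype.sum_prod_type, Finset.sum_eq_single z]
  · simp only [hk, liftObservable, Matrix.of_apply, Equiv.apply_symm_apply, if_true]
    simp [mul_comm]
  · intro z' _ hz
    simp [liftObservable, Ne.symm hz]
  · simp

theorem conjTranspose_mul_liftObservable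
    (hV : ∀ x y, V x y = if (fun i => x (.inl i)) = y then α fun i => x (.inr i) else 0)
    (O : Matrix (Fin r × (S → Bool)) (Fin r × (S → Bool)) ℂ) :
    ((1 : Matrix (Fin r) (Fin r) ℂ) ⊗ₖ V)ᴴ * liftObservable A O =
      O * ((1 : Matrix (Fin r) (Fin r) ℂ) ⊗ₖ V)ᴴ := by
  have h := congrArg Matrix.conjTranspose (liftObservable_mul hV Oᴴ)
  rwa [Matrix.conjTranspose_mul, Matrix.conjTranspose_mul, conjTranspose_liftObservable,
    Matrix.conjTranspose_conjTranspose] at h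

end LiftedObservable

/-! ### One step compared with the exact evolution, to first order. -/

section FirstOrder

open scoped Matrix.Norms.L2Operator

theorem norm_le_one_of_conjTranspose_mul_self {p q : Type*} [Fintype p] [Fintype q] [DecidableEq q]
    {ι : Matrix p q ℂ} (h : ιᴴ * ι = 1) : ‖ι‖ ≤ 1 := by
  have h2 := Matrix.l2_opNorm_conjTranspose_mul_self ι
  have h3 : ‖(1 : Matrix q q ℂ)‖ ≤ 1 := by
    rw [← Matrix.diagonal_one]
    exact norm_diagonal_le zero_le_one fun i => by simp
  rw [h] at h2
  nlinarith [norm_nonneg ι]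

theorem norm_conjTranspose_mul_mul_le {p q : Type*} [Fintype p] [Fintype q] [DecidableEq p]
    [DecidableEq q] {ι : Matrix p q ℂ} (h : ‖ι‖ ≤ 1) (X : Matrix p p ℂ) :
    ‖ιᴴ * X * ι‖ ≤ ‖X‖ := by
  have h' : ‖ιᴴ‖ ≤ 1 := by rwa [Matrix.l2_opNorm_conjTranspose]
  calc ‖ιᴴ * X * ι‖ ≤ ‖ιᴴ‖ * ‖X‖ * ‖ι‖ := (Matrix.l2_opNorm_mul _ _).trans
        (mul_le_mul_of_nonneg_right (Matrix.l2_opNorm_mul _ _) (norm_nonneg _))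
    _ ≤ 1 * ‖X‖ * 1 := by gcongr
    _ = ‖X‖ := by ring

/-- The action on observables of an operator close to the identity, to first order. -/
theorem norm_conj_sub_first_order_le {p q : Type*} [Fintype p] [Fintype q] [DecidableEq p]
    [DecidableEq q] {ι : Matrix p q ℂ} (hι : ιᴴ * ι = 1) {O' : Matrix p p ℂ} {O : Matrix q q ℂ}
    (h₁ : O' * ι = ι * O) (h₂ : ιᴴ * O' = O * ιᴴ) (hO : ‖O'‖ ≤ ‖O‖) {T X : Matrix p p ℂ} {ρ η : ℝ}
    (hρ : ‖T - 1 - X‖ ≤ ρ) (hη : ‖T - 1‖ ≤ η) :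
    ‖(T * ι)ᴴ * O' * (T * ι) - (O + (ιᴴ * X * ι)ᴴ * O + O * (ιᴴ * X * ι))‖ ≤
      (2 * ρ + η ^ 2) * ‖O‖ := by
  have hn := norm_le_one_of_conjTranspose_mul_self hι
  set E := T - 1 with hE
  set R := E - X with hR
  have hT : T * ι = ι + E * ι := by
    rw [hE, Matrix.sub_mul, Matrix.one_mul]
    abel
  have hEX : E = X + R := by
    rw [hR]
    abel
  have e1 : ιᴴ * O' * ι = O := by
    rw [h₂, Matrix.mul_assoc, hι, mul_one]
  -- In both terms linear in `E` the observable moves past the isometry, which leaves the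
  -- compression of `E = X + R`. The quadratic term is only estimated.
  have e2 : ιᴴ * O' * (E * ι) = O * (ιᴴ * X * ι) + O * (ιᴴ * R * ι) := by
    rw [h₂, ← Matrix.mul_add, ← Matrix.add_mul, ← Matrix.mul_add, ← hEX]
    simp only [Matrix.mul_assoc]
  have e3 : (E * ι)ᴴ * O' * ι = (ιᴴ * X * ι)ᴴ * O + (ιᴴ * R * ι)ᴴ * O := by
    rw [Matrix.mul_assoc, h₁, ← Matrix.add_mul, ← Matrix.conjTranspose_add, ← Matrix.add_mul,
      ← Matrix.mul_add, ← hEX]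
    simp only [Matrix.conjTranspose_mul, Matrix.conjTranspose_conjTranspose, Matrix.mul_assoc]
  have e4 : (E * ι)ᴴ * O' * (E * ι) = ιᴴ * (Eᴴ * O' * E) * ι := by
    simp only [Matrix.conjTranspose_mul, Matrix.mul_assoc]
  have e : (T * ι)ᴴ * O' * (T * ι) - (O + (ιᴴ * X * ι)ᴴ * O + O * (ιᴴ * X * ι)) =
      (ιᴴ * R * ι)ᴴ * O + O * (ιᴴ * R * ι) + ιᴴ * (Eᴴ * O' * E) * ι := by
    rw [hT, Matrix.conjTranspose_add, Matrix.add_mul, Matrix.add_mul, Matrix.mul_add, Matrix.mul_add,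
      e1, e2, e3, e4]
    abel
  rw [e]
  have hRn : ‖ιᴴ * R * ι‖ ≤ ρ := (norm_conjTranspose_mul_mul_le hn R).trans hρ
  have a1 : ‖(ιᴴ * R * ι)ᴴ * O‖ ≤ ρ * ‖O‖ := by
    refine (norm_mul_le _ _).trans ?_
    rw [Matrix.l2_opNorm_conjTranspose]
    gcongr
  have a2 : ‖O * (ιᴴ * R * ι)‖ ≤ ρ * ‖O‖ := by
    refine (norm_mul_le _ _).trans ?_
    rw [mul_comm]
    gcongr
  have a3 : ‖ιᴴ * (Eᴴ * O' * E) * ι‖ ≤ η ^ 2 * ‖O‖ := by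
    refine (norm_conjTranspose_mul_mul_le hn _).trans ?_
    have hη0 : 0 ≤ η := (norm_nonneg _).trans hη
    calc ‖Eᴴ * O' * E‖ ≤ ‖Eᴴ‖ * ‖O'‖ * ‖E‖ := (norm_mul_le _ _).trans
          (mul_le_mul_of_nonneg_right (norm_mul_le _ _) (norm_nonneg _))
      _ ≤ η * ‖O‖ * η := by
          rw [Matrix.l2_opNorm_conjTranspose]
          gcongr
      _ = η ^ 2 * ‖O‖ := by ring
  refine (norm_add_le _ _).trans ((add_le_add (norm_add_le _ _) le_rfl).trans ?_)
  linarith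

theorem one_kronecker_sub {p q : Type*} (r : ℕ) (X Y : Matrix p q ℂ) :
    (1 : Matrix (Fin r) (Fin r) ℂ) ⊗ₖ (X - Y) =
      (1 : Matrix (Fin r) (Fin r) ℂ) ⊗ₖ X - (1 : Matrix (Fin r) (Fin r) ℂ) ⊗ₖ Y := by
  ext
  simp [Matrix.kroneckerMap_apply, mul_sub]

variable {Q N b : ℕ}

/-- The evolution that a step approximates. -/
noncomputable def stepEvolution (b : ℕ) (f : AddressFun Q N) :
    Matrix (SysWire Q N → Bool) (SysWire Q N → Bool) ℂ :=
  NormedSpace.exp ((-Complex.I) •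
    ((uniformIsometry Q N b)ᴴ * generator b f * uniformIsometry Q N b))

/-- Both maps are close to the identity and are expanded to first order. Their linear parts differ
only through the rounding error, because the generator is additive in the entries and compression
does not increase the norm. -/
theorem norm_dualChannel_stepGates_sub_le (Z : Table Q N b) (u : ℝ) {f : AddressFun Q N} {m δ : ℝ}
    (hm : 0 ≤ m) (hm1 : m ≤ 1) (hz : ∀ q i j, ‖(Z.lookup q i j).value u‖ ≤ m)
    (hf : ∀ q i j, ‖f q i j‖ ≤ m) (hδ0 : 0 ≤ δ)
    (hδ : ∀ q i j, ‖(Z.lookup q i j).value u - f q i j‖ ≤ δ) {r : ℕ}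
    (O : Matrix (Fin r × (SysWire Q N → Bool)) (Fin r × (SysWire Q N → Bool)) ℂ) :
    ‖dualChannel (listMatrix Z (stepGates Q N b u)) O -
      ((1 : Matrix (Fin r) (Fin r) ℂ) ⊗ₖ stepEvolution b f)ᴴ * O *
        ((1 : Matrix (Fin r) (Fin r) ℂ) ⊗ₖ stepEvolution b f)‖ ≤ (67 * m ^ 2 + 2 * δ) * ‖O‖ := by
  set ι := uniformIsometry Q N b with hι
  set g : AddressFun Q N := fun q i j => (Z.lookup q i j).value u with hg
  have hιι : ιᴴ * ι = 1 := uniformIsometry_conjTranspose_mul_self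
  have hιn := norm_le_one_of_conjTranspose_mul_self hιι
  have hιι' : ((1 : Matrix (Fin r) (Fin r) ℂ) ⊗ₖ ι)ᴴ * ((1 : Matrix (Fin r) (Fin r) ℂ) ⊗ₖ ι) = 1 := by
    rw [Matrix.conjTranspose_kronecker, ← Matrix.mul_kronecker_mul, hιι, Matrix.conjTranspose_one,
      one_mul, Matrix.one_kronecker_one]
  set α : (StepAnc N b → Bool) → ℂ := fun z => if ∀ w, z (.inr w) = false then
    (((√2)⁻¹ : ℝ) : ℂ) ^ (width N + 1) else 0 with hα
  have hentry : ∀ x y, ι x y = if (fun i => x (.inl i)) = y then α fun i => x (.inr i) else 0 := by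
    intro x y
    rw [hι, uniformIsometry, Matrix.of_apply, ite_and]
  have hnI : ∀ {n : Type} [Fintype n] [DecidableEq n] (X : Matrix n n ℂ),
      ‖(-Complex.I) • X‖ = ‖X‖ := fun X => by rw [norm_smul]; simp
  -- the step
  have hm2 : m ^ 2 ≤ m := by nlinarith
  have hT1 := norm_stepMatrix_sub_le Z u hm hm1 hz
  have hG : ‖(-Complex.I) • generator b g‖ ≤ m := by
    rw [hnI]
    exact norm_generator_le hm hz
  have hT2 : ‖stepMatrix Z u - 1‖ ≤ 7 * m := by
    have h := norm_add_le (stepMatrix Z u - 1 - (-Complex.I) • generator b g)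
      ((-Complex.I) • generator b g)
    rw [sub_add_cancel] at h
    linarith
  have hstep := norm_conj_sub_first_order_le hιι' (liftObservable_mul hentry O)
    (conjTranspose_mul_liftObservable hentry O) (norm_liftObservable_le O)
    (T := (1 : Matrix (Fin r) (Fin r) ℂ) ⊗ₖ stepMatrix Z u)
    (X := (1 : Matrix (Fin r) (Fin r) ℂ) ⊗ₖ ((-Complex.I) • generator b g))
    (ρ := 6 * m ^ 2) (η := 7 * m)
    (by
      rw [← Matrix.one_kronecker_one, ← one_kronecker_sub, ← one_kronecker_sub]
      exact (norm_one_kronecker_le r _).trans hT1)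
    (by
      rw [← Matrix.one_kronecker_one, ← one_kronecker_sub]
      exact (norm_one_kronecker_le r _).trans hT2)
  rw [← Matrix.mul_kronecker_mul, one_mul, ← dualChannel_eq_conj _ _ (listMatrix_stepGates Z u) O]
    at hstep
  -- the evolution
  set X := (-Complex.I) • (ιᴴ * generator b f * ι) with hX
  have hXn : ‖X‖ ≤ m := by
    rw [hX, hnI]
    exact (norm_conjTranspose_mul_mul_le hιn _).trans (norm_generator_le hm hf)
  have hU1 : ‖stepEvolution b f - 1 - X‖ ≤ m ^ 2 :=
    (norm_exp_sub_one_sub_le (hXn.trans hm1)).trans (by gcongr)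
  have hU2 : ‖stepEvolution b f - 1‖ ≤ 2 * m := by
    have h := norm_add_le (stepEvolution b f - 1 - X) X
    rw [sub_add_cancel] at h
    linarith
  -- The same expansion for the exact evolution, with the identity in place of the isometry.
  have hevol := norm_conj_sub_first_order_le
    (ι := (1 : Matrix (Fin r × (SysWire Q N → Bool)) (Fin r × (SysWire Q N → Bool)) ℂ))
    (by simp) (O' := O) (O := O) (by simp) (by simp) le_rfl
    (T := (1 : Matrix (Fin r) (Fin r) ℂ) ⊗ₖ stepEvolution b f)
    (X := (1 : Matrix (Fin r) (Fin r) ℂ) ⊗ₖ X) (ρ := m ^ 2) (η := 2 * m)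
    (by
      rw [← Matrix.one_kronecker_one, ← one_kronecker_sub, ← one_kronecker_sub]
      exact (norm_one_kronecker_le r _).trans hU1)
    (by
      rw [← Matrix.one_kronecker_one, ← one_kronecker_sub]
      exact (norm_one_kronecker_le r _).trans hU2)
  simp only [mul_one, Matrix.conjTranspose_one, one_mul] at hevol
  -- the difference of the generators
  set H := ((1 : Matrix (Fin r) (Fin r) ℂ) ⊗ₖ ι)ᴴ *
    ((1 : Matrix (Fin r) (Fin r) ℂ) ⊗ₖ ((-Complex.I) • generator b g)) *
      ((1 : Matrix (Fin r) (Fin r) ℂ) ⊗ₖ ι) with hH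
  have hd : ‖H - (1 : Matrix (Fin r) (Fin r) ℂ) ⊗ₖ X‖ ≤ δ := by
    have e : H - (1 : Matrix (Fin r) (Fin r) ℂ) ⊗ₖ X =
        (1 : Matrix (Fin r) (Fin r) ℂ) ⊗ₖ ((-Complex.I) • (ιᴴ * generator b (g - f) * ι)) := by
      rw [hH, Matrix.conjTranspose_kronecker, ← Matrix.mul_kronecker_mul, ← Matrix.mul_kronecker_mul,
        Matrix.conjTranspose_one, one_mul, one_mul, ← one_kronecker_sub, hX, ← generator_sub,
        Matrix.mul_sub, Matrix.sub_mul, smul_sub, Matrix.mul_smul, Matrix.smul_mul]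
    rw [e]
    refine (norm_one_kronecker_le r _).trans ?_
    rw [hnI]
    exact (norm_conjTranspose_mul_mul_le hιn _).trans (norm_generator_le hδ0 hδ)
  set Y := (1 : Matrix (Fin r) (Fin r) ℂ) ⊗ₖ X with hY
  set W := (1 : Matrix (Fin r) (Fin r) ℂ) ⊗ₖ stepEvolution b f with hW
  set Φ := dualChannel (listMatrix Z (stepGates Q N b u)) O with hΦ
  have hdec : Φ - Wᴴ * O * W = (Φ - (O + Hᴴ * O + O * H)) -
      (Wᴴ * O * W - (O + Yᴴ * O + O * Y)) + ((H - Y)ᴴ * O + O * (H - Y)) := by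
    rw [Matrix.conjTranspose_sub, Matrix.sub_mul, Matrix.mul_sub]
    abel
  have b1 : ‖(H - Y)ᴴ * O‖ ≤ δ * ‖O‖ := by
    refine (norm_mul_le _ _).trans ?_
    rw [Matrix.l2_opNorm_conjTranspose]
    gcongr
  have b2 : ‖O * (H - Y)‖ ≤ δ * ‖O‖ := by
    refine (norm_mul_le _ _).trans ?_
    rw [mul_comm]
    gcongr
  rw [hdec]
  refine (norm_add_le _ _).trans ((add_le_add (norm_sub_le _ _) (norm_add_le _ _)).trans ?_)
  have hO0 := norm_nonneg O
  -- The constant is `67 = 61 + 6`: `12 + 49` from the step and `2 + 4` from the exact evolution.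
  calc _ ≤ (2 * (6 * m ^ 2) + (7 * m) ^ 2) * ‖O‖ + (2 * m ^ 2 + (2 * m) ^ 2) * ‖O‖ +
        (δ * ‖O‖ + δ * ‖O‖) := add_le_add (add_le_add hstep hevol) (add_le_add b1 b2)
    _ = (67 * m ^ 2 + 2 * δ) * ‖O‖ := by ring

end FirstOrder

/-! ### Iteration of the step and identification of the limit evolution. -/

section Evolution

open scoped Matrix.Norms.L2Operator

variable {Q N b : ℕ}

theorem norm_stepEvolution_le {f : AddressFun Q N} (hf : ∀ q i j, star (f q i j) = f q j i) :
    ‖stepEvolution b f‖ ≤ 1 := by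
  set H := (uniformIsometry Q N b)ᴴ * generator b f * uniformIsometry Q N b with hH
  have hH' : IsSelfAdjoint H := by
    ext x y
    rw [Matrix.star_apply, hH, uniformIsometry_generator hf, uniformIsometry_generator hf]
    by_cases h : (fun i => x (.inl i)) = (fun i => y (.inl i))
    · rw [if_pos h, if_pos h.symm, star_mul', hf, h]
      simp
    · rw [if_neg h, if_neg (Ne.symm h), star_zero]
  let +nondep : NormedAlgebra ℚ (Matrix (SysWire Q N → Bool) (SysWire Q N → Bool) ℂ) :=
    .restrictScalars ℚ ℂ _
  have h := NormedSpace.exp_mem_unitary_of_mem_skewAdjoint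
    (hH'.smul_mem_skewAdjoint (r := -Complex.I) (by simp [skewAdjoint.mem_iff]))
  exact norm_le_one_of_conjTranspose_mul_self (Unitary.star_mul_self_of_mem h)

/-- The pulled-back observable is only bounded by `(1 + e) * ‖O‖`, from the error estimate itself.
The error therefore grows geometrically instead of linearly, which costs only a constant factor
later. -/
theorem norm_dualChannel_iterate_sub_le {c : Circuit Q N b} {Z : Table Q N b}
    {V : Matrix (SysWire Q N → Bool) (SysWire Q N → Bool) ℂ} (hV : ‖V‖ ≤ 1) {e : ℝ} (he : 0 ≤ e)
    {r : ℕ}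
    (h : ∀ O : Matrix (Fin r × (SysWire Q N → Bool)) (Fin r × (SysWire Q N → Bool)) ℂ,
      ‖dualChannel (listMatrix Z c.gates) O - ((1 : Matrix (Fin r) (Fin r) ℂ) ⊗ₖ V)ᴴ * O *
        ((1 : Matrix (Fin r) (Fin r) ℂ) ⊗ₖ V)‖ ≤ e * ‖O‖) (n : ℕ)
    (O : Matrix (Fin r × (SysWire Q N → Bool)) (Fin r × (SysWire Q N → Bool)) ℂ) :
    ‖dualChannel (listMatrix Z (c.iterate n).gates) O -
      ((1 : Matrix (Fin r) (Fin r) ℂ) ⊗ₖ (V ^ n))ᴴ * O *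
        ((1 : Matrix (Fin r) (Fin r) ℂ) ⊗ₖ (V ^ n))‖ ≤ ((1 + e) ^ n - 1) * ‖O‖ := by
  induction n generalizing O with
  | zero =>
    have h0 : dualChannel (listMatrix Z (c.iterate 0).gates) O = O := dualChannel_empty Z O
    rw [h0]
    simp
  | succ n ih =>
    have h0 : dualChannel (listMatrix Z (c.iterate (n + 1)).gates) O =
        dualChannel (listMatrix Z (c.iterate n).gates) (dualChannel (listMatrix Z c.gates) O) :=
      dualChannel_comp Z (c.iterate n) c O
    set Y := dualChannel (listMatrix Z c.gates) O with hY
    set Vh := (1 : Matrix (Fin r) (Fin r) ℂ) ⊗ₖ V with hVh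
    set Vn := (1 : Matrix (Fin r) (Fin r) ℂ) ⊗ₖ (V ^ n) with hVn
    have e1 : (1 : Matrix (Fin r) (Fin r) ℂ) ⊗ₖ (V ^ (n + 1)) = Vh * Vn := by
      rw [hVh, hVn, ← Matrix.mul_kronecker_mul, one_mul, pow_succ']
    have hVh1 : ‖Vh‖ ≤ 1 := (norm_one_kronecker_le r V).trans hV
    have hVn1 : ‖Vn‖ ≤ 1 := by
      refine (norm_one_kronecker_le r _).trans ?_
      rcases Nat.eq_zero_or_pos n with h | h
      · rw [h, pow_zero]
        exact norm_le_one_of_conjTranspose_mul_self (by simp)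
      · exact (norm_pow_le' V h).trans (pow_le_one₀ (norm_nonneg _) hV)
    have hd := h O
    have hYn : ‖Y‖ ≤ (1 + e) * ‖O‖ := by
      have h1 := norm_add_le (Y - Vhᴴ * O * Vh) (Vhᴴ * O * Vh)
      rw [sub_add_cancel] at h1
      have h2 := norm_conjTranspose_mul_mul_le hVh1 O
      linarith
    have hsplit : dualChannel (listMatrix Z (c.iterate n).gates) Y - (Vh * Vn)ᴴ * O * (Vh * Vn) =
        (dualChannel (listMatrix Z (c.iterate n).gates) Y - Vnᴴ * Y * Vn) +
          Vnᴴ * (Y - Vhᴴ * O * Vh) * Vn := by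
      rw [Matrix.mul_sub, Matrix.sub_mul, Matrix.conjTranspose_mul]
      simp only [Matrix.mul_assoc]
      abel
    have hpow : 0 ≤ (1 + e) ^ n - 1 := sub_nonneg.2 (one_le_pow₀ (by linarith))
    rw [h0, e1, hsplit]
    calc _ ≤ ((1 + e) ^ n - 1) * ((1 + e) * ‖O‖) + e * ‖O‖ :=
          (norm_add_le _ _).trans (add_le_add
            ((ih Y).trans (mul_le_mul_of_nonneg_left hYn hpow))
            ((norm_conjTranspose_mul_mul_le hVn1 _).trans hd))
      _ = ((1 + e) ^ (n + 1) - 1) * ‖O‖ := by ring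

/-- The matrices `A`, as a function of addresses that vanishes out of range. -/
noncomputable def paddedEntry (A : Fin Q → Matrix (Fin N) (Fin N) ℂ) : AddressFun Q N :=
  fun x y z => if h : Nat.ofBits x < Q ∧ Nat.ofBits y < N ∧ Nat.ofBits z < N then
    A ⟨Nat.ofBits x, h.1⟩ ⟨Nat.ofBits y, h.2.1⟩ ⟨Nat.ofBits z, h.2.2⟩ else 0

theorem star_paddedEntry {A : Fin Q → Matrix (Fin N) (Fin N) ℂ} (hA : ∀ q, (A q).IsHermitian)
    (q : Fin (width Q) → Bool) (i j : Fin (width N) → Bool) :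
    star (paddedEntry A q i j) = paddedEntry A q j i := by
  unfold paddedEntry
  by_cases h : Nat.ofBits q < Q ∧ Nat.ofBits i < N ∧ Nat.ofBits j < N
  · rw [dif_pos h, dif_pos ⟨h.1, h.2.2, h.2.1⟩]
    exact (hA _).apply _ _
  · rw [dif_neg h, dif_neg fun h' => h ⟨h'.1, h'.2.2, h'.2.1⟩, star_zero]

/-- The padded entries vanish out of range, so the generator preserves the encoded subspace and each
of its blocks, and there it acts as a multiple of `A q`. Intertwining passes to the exponentials. -/
theorem stepEvolution_pow_mul_encodeMatrix {A : Fin Q → Matrix (Fin N) (Fin N) ℂ}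
    (hA : ∀ q, (A q).IsHermitian) (t : ℝ) {n : ℕ} (hn : n ≠ 0) {s : ℝ}
    (hs : s = t / n * (2 ^ width N / N)) :
    stepEvolution b (fun q i j => (s : ℂ) * paddedEntry A q i j) ^ n * encodeMatrix Q N =
      encodeMatrix Q N * parallelEvolution A t := by
  have hf : ∀ q i j, star ((s : ℂ) * paddedEntry A q i j) = (s : ℂ) * paddedEntry A q j i := by
    intro q i j
    rw [star_mul', star_paddedEntry hA, RCLike.star_def, Complex.conj_ofReal]
  set X := (uniformIsometry Q N b)ᴴ *
    generator b (fun q i j => (s : ℂ) * paddedEntry A q i j) * uniformIsometry Q N b with hX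
  rw [stepEvolution, ← hX, ← Matrix.exp_nsmul]
  have key : ∀ q : Fin Q, (n • (-Complex.I) • X) * (encodeMatrix Q N).submatrix id (fun j => (q, j)) =
      (encodeMatrix Q N).submatrix id (fun j => (q, j)) *
        ((-Complex.I * (t / N : ℂ)) • A q) := by
    intro q
    ext x j
    rw [Matrix.mul_apply, Matrix.mul_apply, Finset.sum_eq_single (sysLabel (q, j))]
    · have hx : X x (sysLabel (q, j)) = _ := uniformIsometry_generator hf x (sysLabel (q, j))
      have hlq : (fun i => (sysLabel (q, j) : SysWire Q N → Bool) (.inl i)) = label (width Q) q :=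
        rfl
      have hlj : (fun i => (sysLabel (q, j) : SysWire Q N → Bool) (.inr i)) = label (width N) j :=
        rfl
      rw [hlq, hlj] at hx
      have hbq := ofBits_label q.2
      have hbj := ofBits_label j.2
      simp only [Matrix.smul_apply, hx, Matrix.submatrix_apply, id, encodeMatrix, Matrix.of_apply,
        if_true, mul_one]
      -- The factor `2 ^ width N / N` in `s` corrects the normalization of the uniform
      -- superposition.
      have hcoef : (n : ℂ) * (((2 : ℂ) ^ width N)⁻¹ * (s : ℂ)) = (t / N : ℂ) := by
        rw [hs]
        have : (n : ℂ) ≠ 0 := by exact_mod_cast hn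
        push_cast
        field_simp
      by_cases hx1 : (fun i => x (.inl i)) = label (width Q) q
      · by_cases hx2 : Nat.ofBits (fun i => x (.inr i)) < N
        · have hxl : x = sysLabel (q, ⟨_, hx2⟩) := by
            funext w
            rcases w with w | w
            · exact congrFun hx1 w
            · exact (congrFun (label_ofBits fun i => x (.inr i)) w).symm
          rw [Finset.sum_eq_single (⟨_, hx2⟩ : Fin N)]
          · rw [if_pos hxl, if_pos hx1, hx1, paddedEntry,
              dif_pos ⟨by rw [hbq]; exact q.2, hx2, by rw [hbj]; exact j.2⟩]
            simp only [hbq, hbj, Fin.eta, nsmul_eq_mul, smul_eq_mul, one_mul]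
            linear_combination (-Complex.I * A q ⟨_, hx2⟩ j) * hcoef
          · intro i _ hi
            rw [if_neg, zero_mul]
            intro h'
            rw [hxl] at h'
            exact hi (Prod.ext_iff.1 (sysLabel_injective h')).2.symm
          · simp
        · have hz : paddedEntry A (fun i => x (.inl i)) (fun i => x (.inr i)) (label (width N) j) =
              0 := by
            rw [paddedEntry, dif_neg]
            exact fun h' => hx2 h'.2.1
          rw [hz, Finset.sum_eq_zero]
          · simp
          · intro i _
            rw [if_neg, zero_mul]
            intro h'
            apply hx2
            have h2 : (fun i => x (.inr i)) = label (width N) i := by rw [h']; rfl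
            rw [h2, ofBits_label i.2]
            exact i.2
      · rw [if_neg hx1, Finset.sum_eq_zero]
        · simp
        · intro i _
          rw [if_neg, zero_mul]
          intro h'
          exact hx1 (by rw [h']; rfl)
    · intro v _ hv
      simp [encodeMatrix, hv]
    · simp
  ext x ⟨q, j⟩
  have h1 := congrFun (congrFun (exp_mul_of_mul_eq (key q)) x) j
  have h2 : (NormedSpace.exp (n • (-Complex.I) • X) * encodeMatrix Q N) x (q, j) =
      (NormedSpace.exp (n • (-Complex.I) • X) *
        (encodeMatrix Q N).submatrix id (fun j => (q, j))) x j := rfl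
  rw [h2, h1, Matrix.mul_apply, Matrix.mul_apply, Fintype.sum_prod_type, Finset.sum_eq_single q]
  · refine Finset.sum_congr rfl fun i _ => ?_
    rw [Matrix.submatrix_apply, parallelEvolution, Matrix.sum_apply]
    simp [Matrix.kroneckerMap_apply, Matrix.single_apply]
  · intro q' _ hq'
    refine Finset.sum_eq_zero fun i _ => ?_
    rw [parallelEvolution, Matrix.sum_apply]
    rw [Finset.sum_eq_zero, mul_zero]
    intro q'' _
    rw [Matrix.kroneckerMap_apply, Matrix.single_apply, if_neg, zero_mul]
    rintro ⟨h', h''⟩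
    exact hq' (h'.symm.trans h'')
  · simp

end Evolution

/-! ### Numerical bounds. -/

section Bounds

/-- Here `y ≤ 1.02`, so by convexity the exponential lies below its chord on `[0, 1.02]`, whose
slope is at most `1.8 / 1.02`. This gives the bound `0.9 * ε`. -/
theorem exp_sub_one_le {y ε : ℝ} (hy : 0 ≤ y) (hyε : y ≤ 0.51 * ε) (hε : ε ≤ 2) :
    Real.exp y - 1 ≤ ε := by
  have h1 : Real.exp 1.02 ≤ 2.8 := by
    have e : (1.02 : ℝ) = 1 + 0.02 := by norm_num
    have h2 := Real.abs_exp_sub_one_sub_id_le (x := 0.02) (by norm_num [abs_of_pos])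
    have h3 := (abs_le.1 h2).2
    rw [e, Real.exp_add]
    nlinarith [Real.exp_one_lt_d9, Real.exp_pos 1, Real.exp_pos 0.02]
  have ha : 0 ≤ 1 - y / 1.02 := by
    rw [sub_nonneg, div_le_one (by norm_num)]
    linarith
  have hb : 0 ≤ y / 1.02 := by positivity
  have h2 := convexOn_exp.2 (Set.mem_univ 0) (Set.mem_univ 1.02) ha hb (by ring)
  have e : (1 - y / 1.02) • (0 : ℝ) + (y / 1.02) • (1.02 : ℝ) = y := by
    simp only [smul_eq_mul]
    ring
  rw [e, Real.exp_zero] at h2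
  simp only [smul_eq_mul] at h2
  have h3 : y / 1.02 * Real.exp 1.02 ≤ y / 1.02 * 2.8 := by gcongr
  have h4 : y / 1.02 = y * (1 / 1.02) := by ring
  rw [h4] at h2 h3
  linarith

theorem two_pow_width_le {N : ℕ} (hN : 0 < N) : (2 : ℝ) ^ width N / N ≤ 2 := by
  have hN' : (0 : ℝ) < N := by exact_mod_cast hN
  rw [div_le_iff₀ hN']
  have h : 2 ^ width N ≤ 2 * N := by
    rcases Nat.lt_or_ge 1 N with h1 | h1
    · have h2 := Nat.pow_pred_clog_lt_self (b := 2) (by norm_num) h1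
      have h3 : 0 < Nat.clog 2 N := Nat.clog_pos (by norm_num) h1
      have h4 : width N = (Nat.clog 2 N).pred + 1 := by
        rw [width]
        exact (Nat.succ_pred_eq_of_pos h3).symm
      rw [h4, pow_succ]
      omega
    · have : N = 1 := by omega
      subst this
      simp [width]
  exact_mod_cast h

theorem width_le (N : ℕ) : (width N : ℝ) ≤ 1 + 2 * Real.log N := by
  have h0 : 0 ≤ Real.log N := Real.log_natCast_nonneg N
  have h1 : width N = ⌈Real.logb 2 N⌉₊ := by
    rw [width]
    exact_mod_cast (Real.natCeil_logb_natCast 2 N).symm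
  have h2 : 0 ≤ Real.logb 2 N := div_nonneg h0 (Real.log_nonneg (by norm_num))
  have h3 := (Nat.ceil_lt_add_one h2).le
  have h4 : Real.logb 2 N ≤ 2 * Real.log N := by
    rw [Real.logb, div_le_iff₀ (Real.log_pos (by norm_num))]
    nlinarith [Real.log_two_gt_d9]
  rw [h1]
  linarith

theorem value_mul (s u : ℝ) {b : ℕ} (z : Word b) : z.value (s * u) = (s : ℂ) * z.value u := by
  apply Complex.ext <;> simp [Word.value, fixedPoint, mul_assoc]

end Bounds

/-! ### Choice of the number of steps, total error and total time. -/

section Simulation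

open scoped Matrix.Norms.L2Operator

variable {Q N b : ℕ}

theorem norm_entry_le_maxAbsEntry (A : Fin Q → Matrix (Fin N) (Fin N) ℂ) (q : Fin Q) (i j : Fin N) :
    ‖A q i j‖ ≤ maxAbsEntry A :=
  le_ciSup (f := fun p : Fin Q × Fin N × Fin N => ‖A p.1 p.2.1 p.2.2‖)
    (Set.finite_range _).bddAbove (q, i, j)

theorem norm_paddedEntry_le {A : Fin Q → Matrix (Fin N) (Fin N) ℂ} {M : ℝ} (hM : 0 ≤ M)
    (hA : maxAbsEntry A ≤ M) (q : Fin (width Q) → Bool) (i j : Fin (width N) → Bool) :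
    ‖paddedEntry A q i j‖ ≤ M := by
  unfold paddedEntry
  split_ifs
  · exact (norm_entry_le_maxAbsEntry A _ _ _).trans hA
  · simpa using hM

theorem norm_lookup_value_sub_le {A : Fin Q → Matrix (Fin N) (Fin N) ℂ} {Z : Table Q N b}
    {u t ε : ℝ} (hε : 0 ≤ ε) (hZ : ∀ q i j, 8 * |t| * ‖A q i j - (Z q i j).value u‖ ≤ ε)
    (q : Fin (width Q) → Bool) (i j : Fin (width N) → Bool) :
    8 * |t| * ‖(Z.lookup q i j).value u - paddedEntry A q i j‖ ≤ ε := by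
  unfold Table.lookup paddedEntry
  split_ifs
  · rw [norm_sub_rev]
    exact hZ _ _ _
  · have h0 : Word.value u ((fun _ => false, fun _ => false) : Word b) = 0 := by
      apply Complex.ext <;> simp [Word.value, fixedPoint]
    rw [h0]
    simpa using hε

theorem star_ofReal_mul_paddedEntry {A : Fin Q → Matrix (Fin N) (Fin N) ℂ}
    (hA : ∀ q, (A q).IsHermitian) (s : ℝ) (q : Fin (width Q) → Bool)
    (i j : Fin (width N) → Bool) :
    star ((s : ℂ) * paddedEntry A q i j) = (s : ℂ) * paddedEntry A q j i := by
  rw [star_mul', star_paddedEntry hA, RCLike.star_def, Complex.conj_ofReal]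

/-- Both the identity and conjugation by a contraction do not increase the norm of an observable, so
they differ by at most `2 * ‖O‖`. -/
theorem simulates_empty {ε : ℝ} (hε : 2 ≤ ε) {A : Fin Q → Matrix (Fin N) (Fin N) ℂ}
    (hA : ∀ q, (A q).IsHermitian) (Z : Table Q N b) (t : ℝ) :
    (Circuit.empty : Circuit Q N b).Simulates Z (parallelEvolution A t) ε := by
  have hV := stepEvolution_pow_mul_encodeMatrix (b := b) hA t one_ne_zero rfl
  rw [pow_one] at hV
  refine simulates_of_dualChannel (by linarith) hV fun r O => ?_
  rw [dualChannel_empty]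
  refine (norm_sub_le _ _).trans ?_
  have h := norm_conjTranspose_mul_mul_le ((norm_one_kronecker_le r _).trans
    (norm_stepEvolution_le (b := b) (star_ofReal_mul_paddedEntry hA
      (t / (1 : ℕ) * (2 ^ width N / N))))) O
  nlinarith [norm_nonneg O]

/-- With sufficiently many steps, the iterated step simulates the evolution. -/
theorem simulates_iterate {ε u t M : ℝ} (hN : 0 < N) (hε : 0 < ε) (hε2 : ε ≤ 2) {n : ℕ}
    (hn : 60000 * max 1 (M ^ 2 * t ^ 2 / ε) ≤ n) (hM : 0 ≤ M)
    {A : Fin Q → Matrix (Fin N) (Fin N) ℂ} (hA : ∀ q, (A q).IsHermitian) (hAM : maxAbsEntry A ≤ M)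
    {Z : Table Q N b} (hZ : ∀ q i j, 8 * |t| * ‖A q i j - (Z q i j).value u‖ ≤ ε) :
    ((stepCircuit Q N b (t / n * (2 ^ width N / N) * u)).iterate n).Simulates Z
      (parallelEvolution A t) ε := by
  set μ := max 1 (M ^ 2 * t ^ 2 / ε) with hμ
  set s := t / n * (2 ^ width N / N) with hs
  have hμ1 : 1 ≤ μ := le_max_left _ _
  have hμ2 : M ^ 2 * t ^ 2 ≤ μ * ε := (div_le_iff₀ hε).1 (le_max_right _ _)
  have hn0 : (0 : ℝ) < n := by linarith
  have hn1 : n ≠ 0 := fun h => by simp [h] at hn0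
  have hsabs : |s| ≤ 2 * (|t| / n) := by
    rw [hs, abs_mul, abs_div, Nat.abs_cast, abs_of_nonneg (by positivity : (0 : ℝ) ≤ 2 ^ width N / N),
      mul_comm]
    exact mul_le_mul_of_nonneg_right (two_pow_width_le hN) (by positivity)
  set f : AddressFun Q N := fun q i j => (s : ℂ) * paddedEntry A q i j with hf
  -- Since `|s| ≤ 2 * |t| / n`, the condition on the table makes the rounding error of a rescaled
  -- entry at most this `δ`. Over `n` steps the contribution `2 * δ` uses up `ε / 2`.
  set δ := ε / (4 * n) with hδ
  set m := 2 * (|t| / n) * M + δ with hm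
  have hδ0 : 0 ≤ δ := by positivity
  have hm0 : 0 ≤ m := by positivity
  have hmδ : ∀ q i j, ‖(Z.lookup q i j).value (s * u) - f q i j‖ ≤ δ := by
    intro q i j
    rw [value_mul, hf, ← mul_sub, norm_mul, Complex.norm_real, Real.norm_eq_abs]
    have h := norm_lookup_value_sub_le hε.le hZ q i j
    set a := ‖(Z.lookup q i j).value u - paddedEntry A q i j‖ with ha
    calc |s| * a ≤ 2 * (|t| / n) * a := mul_le_mul_of_nonneg_right hsabs (norm_nonneg _)
      _ = (8 * |t| * a) / (4 * n) := by
        field_simp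
        ring
      _ ≤ δ := by
        rw [hδ]
        gcongr
  have hfm' : ∀ q i j, ‖f q i j‖ ≤ 2 * (|t| / n) * M := by
    intro q i j
    rw [hf, norm_mul, Complex.norm_real, Real.norm_eq_abs]
    exact mul_le_mul hsabs (norm_paddedEntry_le hM hAM q i j) (norm_nonneg _) (by positivity)
  have hfm : ∀ q i j, ‖f q i j‖ ≤ m := fun q i j => (hfm' q i j).trans (by linarith)
  have hzm : ∀ q i j, ‖(Z.lookup q i j).value (s * u)‖ ≤ m := by
    intro q i j
    have h := norm_add_le ((Z.lookup q i j).value (s * u) - f q i j) (f q i j)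
    rw [sub_add_cancel] at h
    linarith [hmδ q i j, hfm' q i j]
  -- The part with `M` gives `8 * μ * ε / n`, and the part with `δ` gives at most `μ * ε / (4 * n)`
  -- because `ε ≤ 2`; moreover `n` is at least `60000 * μ`.
  have hnm : n * m ^ 2 ≤ 8.25 * ε / 60000 := by
    have h1 : m ^ 2 ≤ 2 * (2 * (|t| / n) * M) ^ 2 + 2 * δ ^ 2 := by
      rw [hm]
      nlinarith [sq_nonneg (2 * (|t| / n) * M - δ)]
    have h2 : n * (2 * (2 * (|t| / n) * M) ^ 2 + 2 * δ ^ 2) =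
        (8 * (M ^ 2 * t ^ 2) + ε ^ 2 / 8) / n := by
      rw [hδ, ← sq_abs t]
      field_simp
      ring
    have h3 : ε ^ 2 ≤ 2 * (μ * ε) := by nlinarith
    calc n * m ^ 2 ≤ n * (2 * (2 * (|t| / n) * M) ^ 2 + 2 * δ ^ 2) :=
          mul_le_mul_of_nonneg_left h1 hn0.le
      _ = (8 * (M ^ 2 * t ^ 2) + ε ^ 2 / 8) / n := h2
      _ ≤ 8.25 * ε / 60000 := by
        rw [div_le_div_iff₀ hn0 (by norm_num)]
        nlinarith
  have hm1 : m ≤ 1 := by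
    have h1 : m ^ 2 ≤ 1 := by nlinarith [sq_nonneg m]
    nlinarith
  set e := 67 * m ^ 2 + 2 * δ with he
  have he0 : 0 ≤ e := by positivity
  -- Rounding gives `0.5 * ε`, and `67 * 8.25 / 60000` is less than `0.01`.
  have hne : n * e ≤ 0.51 * ε := by
    have h1 : n * (2 * δ) = ε / 2 := by
      rw [hδ]
      field_simp
      ring
    have h2 : n * e = 67 * (n * m ^ 2) + n * (2 * δ) := by
      rw [he]
      ring
    rw [h2, h1]
    linarith
  refine simulates_of_dualChannel hε.le (stepEvolution_pow_mul_encodeMatrix (b := b) hA t hn1 hs)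
    fun r O => ?_
  refine (norm_dualChannel_iterate_sub_le
    (norm_stepEvolution_le (star_ofReal_mul_paddedEntry hA s)) he0 (fun O => ?_) n O).trans ?_
  · rw [dualChannel_stepCircuit]
    exact norm_dualChannel_stepGates_sub_le Z (s * u) hm0 hm1 hzm hfm hδ0 hmδ O
  · refine mul_le_mul_of_nonneg_right ?_ (norm_nonneg _)
    refine le_trans ?_ (exp_sub_one_le (mul_nonneg hn0.le he0) hne hε2)
    have h1 : (1 + e) ^ n ≤ Real.exp (n * e) := by
      rw [Real.exp_nat_mul]
      refine pow_le_pow_left₀ (by linarith) ?_ n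
      linarith [Real.add_one_le_exp e]
    linarith

/-- The word length is bounded by `τ` and the width by the logarithm, so a step costs at most `6 * L
+ 2 + 4 * τ`. The absolute value of `c₀` keeps the constant positive for every `c₀`. -/
theorem time_iterate_stepCircuit_le {τ : ℕ} {c₀ v μ : ℝ} {k₀ n : ℕ} (hQ : 0 < Q) (hN : 0 < N)
    (hb : 2 * (b + 1) ≤ τ) (hτ : (τ : ℝ) ≤ c₀ * (1 + Real.log ((N : ℝ) ^ 2 * Q)) ^ k₀)
    (hμ : 1 ≤ μ) (hn : (n : ℝ) ≤ 60000 * μ + 1) :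
    (((stepCircuit Q N b v).iterate n).time τ : ℝ) ≤
      60001 * (8 + 4 * |c₀|) * μ * (1 + Real.log ((N : ℝ) ^ 2 * Q)) ^ (k₀ + 1) := by
  have hQ1 : (1 : ℝ) ≤ Q := by exact_mod_cast hQ
  have hN1 : (1 : ℝ) ≤ N := by exact_mod_cast hN
  have hlog : Real.log ((N : ℝ) ^ 2 * Q) = 2 * Real.log N + Real.log Q := by
    rw [Real.log_mul (by positivity) (by positivity), Real.log_pow]
    norm_num
  have hlN := Real.log_nonneg hN1
  have hlQ := Real.log_nonneg hQ1
  set L := 1 + Real.log ((N : ℝ) ^ 2 * Q) with hL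
  have hL1 : 1 ≤ L := by
    rw [hL, hlog]
    linarith
  have hw : (width N : ℝ) ≤ L := by
    rw [hL, hlog]
    linarith [width_le N]
  have hp1 : L ≤ L ^ (k₀ + 1) := le_self_pow₀ hL1 (by omega)
  have hp2 : L ^ k₀ ≤ L ^ (k₀ + 1) := pow_le_pow_right₀ hL1 (by omega)
  have hb' : (2 : ℝ) * (b + 1) ≤ τ := by exact_mod_cast hb
  have hτ' : (τ : ℝ) ≤ |c₀| * L ^ (k₀ + 1) := hτ.trans (mul_le_mul (le_abs_self _) hp2
    (by positivity) (abs_nonneg _))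
  rw [Circuit.time_iterate, time_stepCircuit]
  push_cast
  have hstep : 6 * (width N : ℝ) + 4 * (b + 1) + 2 + 2 * τ ≤ (8 + 4 * |c₀|) * L ^ (k₀ + 1) := by
    linarith
  calc (n : ℝ) * (6 * (width N : ℝ) + 4 * (b + 1) + 2 + 2 * τ) ≤
        (60001 * μ) * ((8 + 4 * |c₀|) * L ^ (k₀ + 1)) :=
        mul_le_mul (by linarith) hstep (by positivity) (by positivity)
    _ = _ := by ring

end Simulation

end ParHamSim

open ParHamSim in
theorem theorem1 (c₀ : ℝ) (k₀ : ℕ) :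
    ∃ (C : ℝ) (k : ℕ), ∀ (Q N b τ : ℕ) (u M t ε : ℝ),
      0 < Q → 0 < N → 0 < ε → 2 * (b + 1) ≤ τ →
      (τ : ℝ) ≤ c₀ * (1 + Real.log ((N : ℝ) ^ 2 * Q)) ^ k₀ →
      ∃ c : Circuit Q N b,
        (c.time τ : ℝ) ≤ C * max 1 (M ^ 2 * t ^ 2 / ε) * (1 + Real.log ((N : ℝ) ^ 2 * Q)) ^ k ∧
        ∀ A : Fin Q → Matrix (Fin N) (Fin N) ℂ, (∀ q, (A q).IsHermitian) → maxAbsEntry A ≤ M →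
          ∀ Z : Table Q N b,
            (∀ q i j, 8 * |t| * ‖A q i j - (Z q i j).value u‖ ≤ ε) →
            c.Simulates Z (parallelEvolution A t) ε := by
  refine ⟨60001 * (8 + 4 * |c₀|), k₀ + 1, fun Q N b τ u M t ε hQ hN hε hb hτ => ?_⟩
  have hμ : 1 ≤ max 1 (M ^ 2 * t ^ 2 / ε) := le_max_left _ _
  -- For `ε ≥ 2` doing nothing is accurate enough; its time bound is the case of zero steps.
  rcases le_total 2 ε with h2 | h2
  · refine ⟨Circuit.empty, ?_, fun A hA _ Z _ => simulates_empty h2 hA Z t⟩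
    have h := time_iterate_stepCircuit_le (b := b) (v := u) (n := 0) hQ hN hb hτ hμ
      (by push_cast; linarith)
    exact h
  · refine ⟨(stepCircuit Q N b (t / ⌈60000 * max 1 (M ^ 2 * t ^ 2 / ε)⌉₊ *
      (2 ^ width N / N) * u)).iterate ⌈60000 * max 1 (M ^ 2 * t ^ 2 / ε)⌉₊, ?_, ?_⟩
    · exact time_iterate_stepCircuit_le hQ hN hb hτ hμ (Nat.ceil_lt_add_one (by linarith)).le
    · intro A hA hAM Z hZ
      have hM : 0 ≤ M := (norm_nonneg _).trans
        ((norm_entry_le_maxAbsEntry A ⟨0, hQ⟩ ⟨0, hN⟩ ⟨0, hN⟩).trans hAM)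
      exact simulates_iterate hN hε h2 (Nat.le_ceil _) hM hA hAM hZ
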